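/- **Theorem 8 (asymptotic weighted Rao–Cramér bounds for the Beta posterior).** For $n\ge 1$ and a real parameter $\theta\in[0,1]$ (and $\theta$ in a neighbourhood of $[0,1]$, for the purpose of differentiation) let $$f_\theta(p)=f^{(n)}_\theta(p)=\frac{\Gamma(n+2)}{\Gamma(n\theta+1)\Gamma(n(1-\theta)+1)}\,p^{n\theta}(1-p)^{n(1-\theta)},\qquad 0<p<1,$$ be the $\mathrm{Beta}(n\theta+1,\,n(1-\theta)+1)$ density; for an integer $x=n\theta$ it equals $(n+1)\binom nx p^x(1-p)^{n-x}$, the posterior density of the success probability after $x$ successes in $n$ trials under a uniform prior. For $\gamma\in[0,1]$ and $k\ge 0$ let $$\phi(p)=\frac{1}{\kappa(\theta)}\,p^{\gamma k}(1-p)^{(1-\gamma)k},\qquad \kappa(\theta)=\int_0^1 p^{\gamma k}(1-p)^{(1-\gamma)k}f_\theta(p)\,dp,$$ $$e(\theta)=\int_0^1 p f_\theta\,dp,\quad g(\theta)=\int_0^1 p\,\phi f_\theta\,dp,\quad \mathbb V^{\phi}(\theta)=\int_0^1 (p-e(\theta))^2\phi f_\theta\,dp,\quad I^{\phi}(\theta)=\int_0^1\Big(\frac{\partial}{\partial\theta}\log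 f_\theta(p)\Big)^2\phi f_\theta\,dp,$$ and let the weighted Rao–Cramér lower bound be $$B_k(n,\theta)=\frac{1}{I^{\phi}(\theta)}\Big(g'(\theta)-\frac{\kappa'(\theta)}{\kappa(\theta)}\,(e(\theta)-g(\theta))\Big)^2 .$$ Fix $\alpha\in(0,1)$ and $\gamma\in[0,1]$. Let either $x_n=\lfloor\alpha n\rfloor$ for all $n$, or $x_n=\alpha n$ for all $n$ (the number of successes treated as a real number), and put $\theta_n=x_n/n$, $\delta_n=\alpha n-x_n\in[0,1)$. Then for each of the weights $k=1$, $k=\sqrt n$, $k=n$ we have $\mathbb V^{\phi}(\theta_n)\ge B_k(n,\theta_n)$ for all $n\ge1$, and as $n\to\infty$: (a) for $k=1$, $$B_1(n,\theta_n)=\frac{\alpha(1-\alpha)}{n}+\frac{1}{n^2}\Big(\frac{1-14\alpha+18\alpha^2+2\gamma-8\alpha\gamma+2\gamma^2}{2}-(1-2\alpha)\delta_n\Big)+O(n^{-5/2});$$ (b) for $k=\sqrt n$, $$B_{\sqrt n}(n,\theta_n)=\frac{\alpha(1-\alpha)+(\alpha-\gamma)^2}{n}+\frac{-2\alpha+\alpha^2+\gamma+2\alpha\gamma-2\gamma^2}{n^{3/2}}+O(n^{-2});$$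 (c) for $k=n$, $$B_n(n,\theta_n)=\frac{(\alpha-\gamma)^2}{4}+\frac1n\Big(C_3(\alpha,\gamma)-\frac{\alpha-\gamma}{2}\,\delta_n\Big)+O(n^{-3/2}),$$ where, with $L=\log\frac{(1-\alpha)(\alpha+\gamma)}{\alpha(2-\alpha-\gamma)}$, $$C_3(\alpha,\gamma)=\frac{(\alpha-\gamma)(1-3\alpha+\gamma)}{2}-\frac{\alpha-\gamma}{2L}-\frac{(\alpha-\gamma)^2}{2(\alpha+\gamma)(2-\alpha-\gamma)L^2}\quad(\gamma\ne\alpha),\qquad C_3(\alpha,\alpha)=\frac{\alpha(1-\alpha)}2 .$$ The constants in $O(\cdot)$ may depend on $\alpha$ and $\gamma$. -/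

import Mathlib

open Filter Asymptotics MeasureTheory

noncomputable section

/-! Weighted statistical functionals of a one-parameter family of densities `f θ z` on the real
line, for an unnormalized weight `w z`.  The weight function is `φ(z, θ) = w z / κ(θ)`, where `κ`
is fixed by `∫ φ(z, θ) f θ z dz = 1`. -/

/-- The normalizing constant `κ(θ) = ∫ w(z) f_θ(z) dz`. -/
def weightNorm (f : ℝ → ℝ → ℝ) (w : ℝ → ℝ) (θ : ℝ) : ℝ := ∫ z, w z * f θ z

/-- The normalized weight function `φ(z, θ) = w(z) / κ(θ)`. -/
def weightFun (f : ℝ → ℝ → ℝ) (w : ℝ → ℝ) (θ z : ℝ) : ℝ := w z / weightNorm f w θ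

/-- The classical expectation `e(θ) = ∫ z f_θ(z) dz`. -/
def classicalMean (f : ℝ → ℝ → ℝ) (θ : ℝ) : ℝ := ∫ z, z * f θ z

/-- The weighted expectation `g(θ) = ∫ z φ(z, θ) f_θ(z) dz`. -/
def weightedMean (f : ℝ → ℝ → ℝ) (w : ℝ → ℝ) (θ : ℝ) : ℝ :=
  ∫ z, z * weightFun f w θ z * f θ z

/-- The weighted variance `∫ (z - e(θ))² φ(z, θ) f_θ(z) dz`, centred at the classical
expectation. -/
def weightedVariance (f : ℝ → ℝ → ℝ) (w : ℝ → ℝ) (θ : ℝ) : ℝ :=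
  ∫ z, (z - classicalMean f θ) ^ 2 * weightFun f w θ z * f θ z

/-- The weighted Fisher information `∫ (∂/∂θ log f_θ(z))² φ(z, θ) f_θ(z) dz`. -/
def weightedFisher (f : ℝ → ℝ → ℝ) (w : ℝ → ℝ) (θ : ℝ) : ℝ :=
  ∫ z, (deriv (fun t => Real.log (f t z)) θ) ^ 2 * weightFun f w θ z * f θ z

/-- The weighted Rao-Cramér lower bound
`(g'(θ) - (κ'(θ) / κ(θ)) (e(θ) - g(θ)))² / I(θ)`. -/
def raoCramerBound (f : ℝ → ℝ → ℝ) (w : ℝ → ℝ) (θ : ℝ) : ℝ :=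
  (deriv (weightedMean f w) θ
      - deriv (weightNorm f w) θ / weightNorm f w θ
        * (classicalMean f θ - weightedMean f w θ)) ^ 2
    / weightedFisher f w θ

/-- The posterior density of the success probability after `n` trials with `x = nθ` successes
(uniform prior): the Beta density with parameters `x + 1` and `n - x + 1`, as a family in the real
parameter `θ`. -/
def posteriorPDF (n : ℕ) (θ p : ℝ) : ℝ :=
  ProbabilityTheory.betaPDFReal (n * θ + 1) (n * (1 - θ) + 1) p

/-- For an integer number `x` of successes this is `(n + 1) C(n, x) p^x (1 - p)^(n - x)`. -/
theorem posteriorPDF_nat {n x : ℕ} (hn : 1 ≤ n) (hx : x ≤ n) {p : ℝ} (h0 : 0 < p) (h1 : p < 1) :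
    posteriorPDF n ((x : ℝ) / n) p = (n + 1) * n.choose x * p ^ x * (1 - p) ^ (n - x) := by
  have hn' : (n : ℝ) ≠ 0 := by positivity
  have e1 : (n : ℝ) * ((x : ℝ) / n) + 1 = x + 1 := by field_simp
  have e2 : (n : ℝ) * (1 - (x : ℝ) / n) + 1 = ((n - x : ℕ) : ℝ) + 1 := by
    push_cast [hx]; field_simp
  have e3 : (x : ℝ) + 1 + (((n - x : ℕ) : ℝ) + 1) = ((n + 1 : ℕ) : ℝ) + 1 := by
    push_cast [hx]; ring
  unfold posteriorPDF ProbabilityTheory.betaPDFReal ProbabilityTheory.beta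
  rw [e1, e2, if_pos ⟨h0, h1⟩, e3, Real.Gamma_nat_eq_factorial, Real.Gamma_nat_eq_factorial,
    Real.Gamma_nat_eq_factorial, add_sub_cancel_right, add_sub_cancel_right, Real.rpow_natCast,
    Real.rpow_natCast, Nat.factorial_succ, Nat.cast_choose ℝ hx]
  have := Nat.factorial_ne_zero x
  have := Nat.factorial_ne_zero (n - x)
  push_cast
  field_simp

/-- The unnormalized weight `p^(γk) (1 - p)^((1 - γ)k)`. -/
def peakWeight (γ k p : ℝ) : ℝ := p ^ (γ * k) * (1 - p) ^ ((1 - γ) * k)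

/-- The coefficient of `1 / n` in the expansion for the weight exponent `k = n`; the value at
`γ = α` is the limit as `γ → α`. -/
def constC3 (α γ : ℝ) : ℝ :=
  if γ = α then α * (1 - α) / 2
  else
    (α - γ) * (1 - 3 * α + γ) / 2
      - (α - γ) / (2 * Real.log ((1 - α) * (α + γ) / (α * (2 - α - γ))))
      - (α - γ) ^ 2 / (2 * (α + γ) * (2 - α - γ)
          * Real.log ((1 - α) * (α + γ) / (α * (2 - α - γ))) ^ 2)

end

/-! Write a = nθ + 1, b = n(1 − θ) + 1, A = a + γk and B = b + (1 − γ)k. Multiplying a Beta density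
by powers of p and 1 − p gives a multiple of another Beta density, so φ f_θ is the Beta(A, B)
density and the functionals have closed forms. The score is n(ℓ(p) − c), where ℓ is the log-odds and
c = ψ(a) − ψ(b) is its mean under Beta(a, b). The moment generating function of ℓ is a quotient of
Beta functions, so under Beta(A, B) it has mean ψ(A) − ψ(B) and variance ψ'(A) + ψ'(B); its
covariance with p is 1/(A + B).

With D = ψ(A) − ψ(B) − c and E = e − g the bound becomes (1/(n + 2 + k) − D E)² / (ψ'(A) + ψ'(B) +
D²), see `raoCramerBound_posterior`. Under Beta(A, B) the numerator is the square of ∫ (p − e)(ℓ −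
c) and the denominator is ∫ (ℓ − c)², so the comparison with the weighted variance is the
Cauchy-Schwarz inequality.

For the asymptotics, explicit bounds on ψ and ψ' come from their unit-step recurrences, and every
ingredient is expanded to two terms in u = 1/n or u = 1/√n with error O(u²) (`TwoTerm`). The cases
differ in the size of D and E. For k = 1 both are O(1/n), and D E, D² are only corrections. For k =
√n both are O(1/√n), and D² competes with the trigamma terms. For k = n and γ ≠ α they tend to L ≠ 0
and (α − γ)/2, and D² dominates. For k = n and γ = α both limits vanish and the scaling is again
that of k = 1. -/

noncomputable section

open Set Topology ProbabilityTheory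

/-! ### The real digamma and trigamma functions on the positive half-line -/

/-- The digamma function on the positive reals, as the derivative of `log Γ`. -/
def realDigamma (x : ℝ) : ℝ := deriv (Real.log ∘ Real.Gamma) x

/-- The trigamma function, as the series `∑ 1 / (x + j)²`. -/
def realTrigamma (x : ℝ) : ℝ := ∑' j : ℕ, 1 / (x + j) ^ 2

theorem hasDerivAt_log_Gamma {x : ℝ} (hx : 0 < x) :
    HasDerivAt (fun y => Real.log (Real.Gamma y)) (realDigamma x) x := by
  have h : DifferentiableAt ℝ (Real.log ∘ Real.Gamma) x := by
    refine (Real.differentiableAt_Gamma ?_).log (Real.Gamma_ne_zero ?_) <;>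
    exact fun m ↦ ne_of_gt (by have : (0 : ℝ) ≤ m := m.cast_nonneg; linarith)
  exact h.hasDerivAt

theorem log_Gamma_add_one {x : ℝ} (hx : 0 < x) :
    Real.log (Real.Gamma (x + 1)) = Real.log (Real.Gamma x) + Real.log x := by
  rw [Real.Gamma_add_one hx.ne', Real.log_mul hx.ne' (Real.Gamma_pos_of_pos hx).ne', add_comm]

theorem realDigamma_add_one {x : ℝ} (hx : 0 < x) :
    realDigamma (x + 1) = realDigamma x + 1 / x := by
  have h1 : HasDerivAt (fun y => Real.log (Real.Gamma (y + 1))) (realDigamma (x + 1)) x :=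
    (hasDerivAt_log_Gamma (by linarith : 0 < x + 1)).comp_add_const x 1
  have h2 : HasDerivAt (fun y => Real.log (Real.Gamma (y + 1))) (realDigamma x + x⁻¹) x := by
    refine ((hasDerivAt_log_Gamma hx).add (Real.hasDerivAt_log hx.ne')).congr_of_eventuallyEq ?_
    filter_upwards [eventually_gt_nhds hx] with y hy using log_Gamma_add_one hy
  rw [h1.unique h2, one_div]

/-- Convexity of log Γ: its slope over [x, x + 1] is exactly log x, which lies between the
derivatives at the two endpoints. -/
theorem log_le_realDigamma_add_one {x : ℝ} (hx : 0 < x) :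
    Real.log x ≤ realDigamma (x + 1) := by
  refine (le_of_eq ?_).trans <| Real.convexOn_log_Gamma.slope_le_deriv (mem_Ioi.mpr hx)
      (mem_Ioi.mpr (by linarith)) (by linarith : x < x + 1)
      (hasDerivAt_log_Gamma (by linarith)).differentiableAt
  rw [slope_def_field, add_sub_cancel_left, div_one, Function.comp, Function.comp,
    log_Gamma_add_one hx, add_sub_cancel_left]

theorem realDigamma_le_log {x : ℝ} (hx : 0 < x) : realDigamma x ≤ Real.log x := by
  refine (Real.convexOn_log_Gamma.deriv_le_slope (mem_Ioi.mpr hx)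
      (mem_Ioi.mpr (by linarith)) (by linarith : x < x + 1)
      (hasDerivAt_log_Gamma hx).differentiableAt).trans (le_of_eq ?_)
  rw [slope_def_field, add_sub_cancel_left, div_one, Function.comp, Function.comp,
    log_Gamma_add_one hx, add_sub_cancel_left]

theorem log_sub_le_realDigamma {x : ℝ} (hx : 0 < x) : Real.log x - 1 / x ≤ realDigamma x := by
  linarith [log_le_realDigamma_add_one hx, realDigamma_add_one hx]

theorem tendsto_realDigamma_sub_log :
    Tendsto (fun x => realDigamma x - Real.log x) atTop (𝓝 0) := by
  have h : Tendsto (fun x : ℝ => -(1 / x)) atTop (𝓝 0) := by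
    simpa using tendsto_inv_atTop_zero (𝕜 := ℝ) |>.neg
  refine tendsto_of_tendsto_of_tendsto_of_le_of_le' h tendsto_const_nhds ?_ ?_
  · filter_upwards [eventually_gt_atTop 0] with x hx
    linarith [log_sub_le_realDigamma hx]
  · filter_upwards [eventually_gt_atTop 0] with x hx
    linarith [realDigamma_le_log hx]

theorem tendsto_const_add_natCast (x : ℝ) : Tendsto (fun n : ℕ => x + n) atTop atTop :=
  tendsto_atTop_add_const_left _ _ tendsto_natCast_atTop_atTop

/-- A function on the positive reals which decreases along unit steps and tends to zero along
them is nonnegative. -/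
theorem nonneg_of_step_antitone {h : ℝ → ℝ} (hstep : ∀ x, 0 < x → h (x + 1) ≤ h x)
    {x : ℝ} (hx : 0 < x) (hlim : Tendsto (fun n : ℕ => h (x + n)) atTop (𝓝 0)) : 0 ≤ h x := by
  have hanti : Antitone fun n : ℕ => h (x + n) := by
    refine antitone_nat_of_succ_le fun n => ?_
    have := hstep (x + n) (by positivity)
    push_cast
    rwa [← add_assoc]
  have := hanti.le_of_tendsto hlim 0
  simpa using this

theorem summable_one_div_add_sq {x : ℝ} (hx : 0 < x) :
    Summable fun j : ℕ => 1 / (x + j) ^ 2 := by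
  refine ((Real.summable_one_div_nat_add_rpow x 2).2 (by norm_num)).congr fun j => ?_
  rw [abs_of_pos (by positivity), add_comm]
  norm_num

theorem realTrigamma_add_one {x : ℝ} (hx : 0 < x) :
    realTrigamma (x + 1) = realTrigamma x - 1 / x ^ 2 := by
  rw [realTrigamma, realTrigamma, (summable_one_div_add_sq hx).tsum_eq_zero_add]
  simp only [Nat.cast_zero, add_zero, Nat.cast_add, Nat.cast_one, add_sub_cancel_left]
  exact tsum_congr fun j => by ring_nf

theorem tendsto_realTrigamma_add_nat (x : ℝ) :
    Tendsto (fun n : ℕ => realTrigamma (x + n)) atTop (𝓝 0) := by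
  refine (tendsto_sum_nat_add fun j : ℕ => 1 / (x + j) ^ 2).congr fun n => ?_
  refine tsum_congr fun j => ?_
  push_cast
  ring_nf

/-- The recurrence telescopes the partial sums into differences of ψ at shifted points, and ψ − log
→ 0 removes the shifted values. This series is what gets differentiated termwise to identify ψ' with
the trigamma series. -/
theorem hasSum_realDigamma {x : ℝ} (hx : 0 < x) :
    HasSum (fun j : ℕ => 1 / (1 + (j : ℝ)) - 1 / (x + j)) (realDigamma x - realDigamma 1) := by
  have hpart (y : ℝ) (hy : 0 < y) (n : ℕ) :
      ∑ j ∈ Finset.range n, 1 / (y + (j : ℝ)) = realDigamma (y + n) - realDigamma y := by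
    induction n with
    | zero => simp
    | succ n ih =>
      rw [Finset.sum_range_succ, ih]
      push_cast
      rw [← add_assoc, realDigamma_add_one (by positivity : 0 < y + n)]
      ring
  have hsum : Summable fun j : ℕ => 1 / (1 + (j : ℝ)) - 1 / (x + j) := by
    -- The j-th term is (x − 1)/((1 + j)(x + j)), and min x 1 + j bounds both factors from below.
    have hm : 0 < min x 1 := lt_min hx one_pos
    refine Summable.of_norm_bounded ((summable_one_div_add_sq hm).mul_left |x - 1|) fun j => ?_
    have h1 : (0 : ℝ) < 1 + j := by positivity
    have h2 : 0 < x + j := by positivity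
    have h3 : 0 < min x 1 + j := by positivity
    rw [div_sub_div _ _ h1.ne' h2.ne', Real.norm_eq_abs, abs_div, abs_of_pos (mul_pos h1 h2),
      mul_one_div, show 1 * (x + (j : ℝ)) - (1 + j) * 1 = x - 1 by ring]
    refine div_le_div_of_nonneg_left (abs_nonneg _) (by positivity) ?_
    rw [sq]
    gcongr
    · exact min_le_right _ _
    · exact min_le_left _ _
  rw [hsum.hasSum_iff_tendsto_nat]
  have hlog : Tendsto (fun n : ℕ => Real.log (1 + n) - Real.log (x + n)) atTop (𝓝 0) := by
    have h1 : Tendsto (fun n : ℕ => Real.log ((1 + n) / (x + n))) atTop (𝓝 (Real.log 1)) := by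
      refine Tendsto.log ?_ one_ne_zero
      have : Tendsto (fun n : ℕ => 1 + (1 - x) / (x + n)) atTop (𝓝 (1 + 0)) :=
        tendsto_const_nhds.add (Tendsto.div_atTop tendsto_const_nhds
          (tendsto_const_add_natCast x))
      rw [add_zero] at this
      refine this.congr fun n => ?_
      have h2 : 0 < x + n := by positivity
      field_simp
      ring
    rw [Real.log_one] at h1
    refine h1.congr fun n => Real.log_div (by positivity) (by positivity)
  have hψ (y : ℝ) := tendsto_realDigamma_sub_log.comp (tendsto_const_add_natCast y)
  have := ((((hψ 1).sub (hψ x)).add hlog).add_const (realDigamma x - realDigamma 1))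
  simp only [sub_zero, zero_add] at this
  refine this.congr fun n => ?_
  rw [Finset.sum_sub_distrib, hpart x hx, hpart 1 one_pos]
  simp only [Function.comp]
  ring

theorem hasDerivAt_realDigamma {x : ℝ} (hx : 0 < x) :
    HasDerivAt realDigamma (realTrigamma x) x := by
  -- On (x/2, ∞) the derivatives of the terms are dominated uniformly by 1/(x/2 + j)².
  have hx2 : 0 < x / 2 := by linarith
  have key : HasDerivAt (fun y => ∑' j : ℕ, (1 / (1 + (j : ℝ)) - 1 / (y + j)))
      (∑' j : ℕ, 1 / (x + (j : ℝ)) ^ 2) x := by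
    refine hasDerivAt_tsum_of_isPreconnected (t := Ioi (x / 2)) (y₀ := x)
      (g := fun (j : ℕ) (y : ℝ) => 1 / (1 + (j : ℝ)) - 1 / (y + j))
      (g' := fun (j : ℕ) (y : ℝ) => 1 / (y + (j : ℝ)) ^ 2)
      (summable_one_div_add_sq hx2) isOpen_Ioi isPreconnected_Ioi ?_ ?_ (by simp; linarith)
      (hasSum_realDigamma hx).summable (by simp; linarith)
    · intro j y hy
      have hy : x / 2 < y := hy
      have hy0 : 0 < y := hx2.trans hy
      have h : 0 < y + j := by positivity
      have := (((hasDerivAt_id y).add_const (j : ℝ)).inv h.ne').const_sub (1 / (1 + (j : ℝ)))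
      simpa [one_div, neg_div] using this
    · intro j y hy
      have hy : x / 2 < y := hy
      have hy0 : 0 < y := hx2.trans hy
      have h : 0 < y + j := by positivity
      rw [Real.norm_eq_abs, abs_of_nonneg (by positivity)]
      gcongr
  refine (key.add_const (realDigamma 1)).congr_of_eventuallyEq ?_
  filter_upwards [eventually_gt_nhds hx] with y hy
  rw [(hasSum_realDigamma hy).tsum_eq]
  ring

/-! ### Explicit bounds for the trigamma and digamma functions. -/

theorem realTrigamma_lower {x : ℝ} (hx : 0 < x) :
    1 / x + 1 / (2 * x ^ 2) ≤ realTrigamma x := by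
  have := nonneg_of_step_antitone (h := fun x => realTrigamma x - (1 / x + 1 / 2 * (1 / x) ^ 2))
    (x := x) ?_ hx ?_
  · have e : 1 / x + 1 / (2 * x ^ 2) = 1 / x + 1 / 2 * (1 / x) ^ 2 := by field_simp
    rw [e]; linarith
  · intro y hy
    have : 1 / y + 1 / 2 * (1 / y) ^ 2 - (1 / (y + 1) + 1 / 2 * (1 / (y + 1)) ^ 2) - 1 / y ^ 2
        = -(1 / (2 * y ^ 2 * (y + 1) ^ 2)) := by field_simp; ring
    have h2 : 0 < 1 / (2 * y ^ 2 * (y + 1) ^ 2) := by positivity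
    simp only [realTrigamma_add_one hy]
    linarith
  · have h1 : Tendsto (fun n : ℕ => 1 / (x + n)) atTop (𝓝 0) :=
      Tendsto.div_atTop tendsto_const_nhds (tendsto_const_add_natCast x)
    simpa [-one_div] using (tendsto_realTrigamma_add_nat x).sub (h1.add ((h1.pow 2).const_mul (1 / 2)))

theorem realTrigamma_upper {x : ℝ} (hx : 0 < x) :
    realTrigamma x ≤ 1 / x + 1 / (2 * x ^ 2) + 1 / (6 * x ^ 3) := by
  have := nonneg_of_step_antitone
    (h := fun x => (1 / x + 1 / 2 * (1 / x) ^ 2 + 1 / 6 * (1 / x) ^ 3) - realTrigamma x)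
    (x := x) ?_ hx ?_
  · have e : 1 / x + 1 / (2 * x ^ 2) + 1 / (6 * x ^ 3)
        = 1 / x + 1 / 2 * (1 / x) ^ 2 + 1 / 6 * (1 / x) ^ 3 := by field_simp
    rw [e]; linarith
  · intro y hy
    have : 1 / y + 1 / 2 * (1 / y) ^ 2 + 1 / 6 * (1 / y) ^ 3
        - (1 / (y + 1) + 1 / 2 * (1 / (y + 1)) ^ 2 + 1 / 6 * (1 / (y + 1)) ^ 3) - 1 / y ^ 2
        = 1 / (6 * y ^ 3 * (y + 1) ^ 3) := by field_simp; ring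
    have h2 : 0 < 1 / (6 * y ^ 3 * (y + 1) ^ 3) := by positivity
    simp only [realTrigamma_add_one hy]
    linarith
  · have h1 : Tendsto (fun n : ℕ => 1 / (x + n)) atTop (𝓝 0) :=
      Tendsto.div_atTop tendsto_const_nhds (tendsto_const_add_natCast x)
    simpa [-one_div] using ((h1.add ((h1.pow 2).const_mul (1 / 2))).add
      ((h1.pow 3).const_mul (1 / 6))).sub (tendsto_realTrigamma_add_nat x)

theorem realTrigamma_pos {x : ℝ} (hx : 0 < x) : 0 < realTrigamma x :=
  lt_of_lt_of_le (by positivity) (realTrigamma_lower hx)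

theorem two_div_le_log_one_add_inv {y : ℝ} (hy : 0 < y) :
    2 / (2 * y + 1) ≤ Real.log (y + 1) - Real.log y := by
  rw [← Real.log_div (by positivity) hy.ne']
  have h := Real.le_log_one_add_of_nonneg (x := 1 / y) (by positivity)
  have e1 : 2 * (1 / y) / (1 / y + 2) = 2 / (2 * y + 1) := by field_simp; ring
  have e2 : 1 + 1 / y = (y + 1) / y := by field_simp
  rwa [e1, e2] at h

theorem log_one_add_inv_le {y : ℝ} (hy : 0 < y) :
    Real.log (y + 1) - Real.log y ≤ (1 / y + 1 / (y + 1)) / 2 := by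
  rw [← Real.log_div (by positivity) hy.ne']
  -- Apply t ≤ sinh t at t = log((y + 1)/y), using sinh(log z) = (z − 1/z)/2.
  have h := Real.self_le_sinh_iff.2 (Real.log_nonneg (x := (y + 1) / y)
    (by rw [le_div_iff₀ hy]; linarith))
  rw [Real.sinh_log (by positivity)] at h
  refine h.trans (le_of_eq ?_)
  field_simp
  ring

theorem realDigamma_upper {x : ℝ} (hx : 0 < x) :
    realDigamma x ≤ Real.log x - 1 / (2 * x) := by
  have := nonneg_of_step_antitone
    (h := fun x => -(realDigamma x - Real.log x) - 1 / 2 * (1 / x)) (x := x) ?_ hx ?_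
  · have e : 1 / (2 * x) = 1 / 2 * (1 / x) := by field_simp
    rw [e]; linarith
  · intro y hy
    simp only [realDigamma_add_one hy]
    linarith [log_one_add_inv_le hy]
  · have h1 : Tendsto (fun n : ℕ => 1 / (x + n)) atTop (𝓝 0) :=
      Tendsto.div_atTop tendsto_const_nhds (tendsto_const_add_natCast x)
    simpa [-one_div] using (tendsto_realDigamma_sub_log.comp (tendsto_const_add_natCast x)).neg.sub
      (h1.const_mul (1 / 2))

/-- The constant 1/8 need not be sharp: it makes the step difference explicitly positive when the
logarithm is replaced by its bound 2/(2y + 1), and only the order x⁻² matters later. -/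
theorem realDigamma_lower {x : ℝ} (hx : 0 < x) :
    Real.log x - 1 / (2 * x) - 1 / (8 * x ^ 2) ≤ realDigamma x := by
  have := nonneg_of_step_antitone
    (h := fun x => (realDigamma x - Real.log x) + 1 / 2 * (1 / x) + 1 / 8 * (1 / x) ^ 2)
    (x := x) ?_ hx ?_
  · have e : 1 / (2 * x) + 1 / (8 * x ^ 2) = 1 / 2 * (1 / x) + 1 / 8 * (1 / x) ^ 2 := by
      field_simp
    linarith
  · intro y hy
    have h1 := two_div_le_log_one_add_inv hy
    have h2 : 2 / (2 * y + 1) - 1 / y - (1 / 2 * (1 / (y + 1)) + 1 / 8 * (1 / (y + 1)) ^ 2)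
        + (1 / 2 * (1 / y) + 1 / 8 * (1 / y) ^ 2)
        = 1 / (8 * y ^ 2 * (y + 1) ^ 2 * (2 * y + 1)) := by
      field_simp; ring
    have h3 : 0 < 1 / (8 * y ^ 2 * (y + 1) ^ 2 * (2 * y + 1)) := by positivity
    simp only [realDigamma_add_one hy]
    linarith
  · have h1 : Tendsto (fun n : ℕ => 1 / (x + n)) atTop (𝓝 0) :=
      Tendsto.div_atTop tendsto_const_nhds (tendsto_const_add_natCast x)
    simpa [-one_div] using ((tendsto_realDigamma_sub_log.comp (tendsto_const_add_natCast x)).add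
      (h1.const_mul (1 / 2))).add ((h1.pow 2).const_mul (1 / 8))

/-! ### The log-odds under a Beta distribution -/

/-- The log-odds `log p - log (1 - p)`. -/
def logOdds (p : ℝ) : ℝ := Real.log p - Real.log (1 - p)

/-- Exponents add, so power weights preserve the Beta family. Outside (0, 1) both sides are zero,
whatever the powers of negative numbers are. -/
theorem rpow_mul_rpow_mul_betaPDFReal {a b s r : ℝ} (ha : 0 < a + s) (hb : 0 < b + r) (p : ℝ) :
    p ^ s * (1 - p) ^ r * betaPDFReal a b p
      = beta (a + s) (b + r) / beta a b * betaPDFReal (a + s) (b + r) p := by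
  unfold betaPDFReal
  split_ifs with hp
  · have h1 : 0 < 1 - p := by linarith [hp.2]
    have h2 := (beta_pos ha hb).ne'
    rw [show a + s - 1 = s + (a - 1) by ring, show b + r - 1 = r + (b - 1) by ring,
      Real.rpow_add hp.1, Real.rpow_add h1]
    field_simp
  · simp

theorem betaPDFReal_nonneg {a b : ℝ} (ha : 0 < a) (hb : 0 < b) (p : ℝ) :
    0 ≤ betaPDFReal a b p := by
  by_cases hp : 0 < p ∧ p < 1
  · exact (betaPDFReal_pos hp.1 hp.2 ha hb).le
  · simp [betaPDFReal, hp]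

theorem integrable_betaPDFReal {a b : ℝ} (ha : 0 < a) (hb : 0 < b) :
    Integrable (betaPDFReal a b) := by
  refine (lintegral_ofReal_ne_top_iff_integrable
    (stronglyMeasurable_betaPDFReal a b).aestronglyMeasurable
    (Eventually.of_forall (betaPDFReal_nonneg ha hb))).1 ?_
  have := lintegral_betaPDF_eq_one ha hb
  unfold betaPDF at this
  simp [this]

theorem integral_betaPDFReal {a b : ℝ} (ha : 0 < a) (hb : 0 < b) :
    ∫ p, betaPDFReal a b p = 1 := by
  rw [integral_eq_lintegral_of_nonneg_ae (Eventually.of_forall (betaPDFReal_nonneg ha hb))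
    (stronglyMeasurable_betaPDFReal a b).aestronglyMeasurable]
  have := lintegral_betaPDF_eq_one ha hb
  unfold betaPDF at this
  simp [this]

theorem measurable_betaPDF (a b : ℝ) : Measurable (betaPDF a b) :=
  (measurable_betaPDFReal a b).ennreal_ofReal

theorem integral_betaMeasure {a b : ℝ} (ha : 0 < a) (hb : 0 < b) (h : ℝ → ℝ) :
    ∫ p, h p ∂betaMeasure a b = ∫ p, h p * betaPDFReal a b p := by
  rw [betaMeasure, integral_withDensity_eq_integral_toReal_smul (measurable_betaPDF a b)
    (Eventually.of_forall fun _ => ENNReal.ofReal_lt_top)]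
  refine integral_congr_ae (Eventually.of_forall fun p => ?_)
  simp only [betaPDF, ENNReal.toReal_ofReal (betaPDFReal_nonneg ha hb p), smul_eq_mul, mul_comm]

theorem integrable_betaMeasure_iff {a b : ℝ} (ha : 0 < a) (hb : 0 < b) (h : ℝ → ℝ) :
    Integrable h (betaMeasure a b) ↔ Integrable fun p => h p * betaPDFReal a b p := by
  rw [betaMeasure, integrable_withDensity_iff (measurable_betaPDF a b)
    (Eventually.of_forall fun _ => ENNReal.ofReal_lt_top)]
  simp only [betaPDF, ENNReal.toReal_ofReal (betaPDFReal_nonneg ha hb _)]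

theorem ae_betaMeasure_mem_Ioo (a b : ℝ) : ∀ᵐ p ∂betaMeasure a b, 0 < p ∧ p < 1 := by
  rw [betaMeasure, ae_withDensity_iff (measurable_betaPDF a b)]
  refine Eventually.of_forall fun p hp => ?_
  by_contra h
  exact hp (by simp [betaPDF, betaPDFReal, h])

theorem exp_mul_logOdds_mul_betaPDFReal {a b t : ℝ} (ha : 0 < a + t) (hb : 0 < b - t) (p : ℝ) :
    Real.exp (t * logOdds p) * betaPDFReal a b p
      = beta (a + t) (b - t) / beta a b * betaPDFReal (a + t) (b - t) p := by
  have key := rpow_mul_rpow_mul_betaPDFReal (a := a) (b := b) (s := t) (r := -t) ha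
    (by simpa [← sub_eq_add_neg] using hb) p
  rw [← sub_eq_add_neg] at key
  rw [← key]
  by_cases hp : 0 < p ∧ p < 1
  · have h1 : 0 < 1 - p := by linarith [hp.2]
    rw [Real.rpow_def_of_pos hp.1, Real.rpow_def_of_pos h1, ← Real.exp_add, logOdds]
    congr 2
    ring
  · simp [betaPDFReal, hp]

theorem integrable_exp_mul_logOdds {a b t : ℝ} (ha : 0 < a) (hb : 0 < b) (hat : 0 < a + t)
    (hbt : 0 < b - t) : Integrable (fun p => Real.exp (t * logOdds p)) (betaMeasure a b) := by
  rw [integrable_betaMeasure_iff ha hb]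
  simp only [exp_mul_logOdds_mul_betaPDFReal hat hbt]
  exact (integrable_betaPDFReal hat hbt).const_mul _

theorem mgf_logOdds {a b t : ℝ} (ha : 0 < a) (hb : 0 < b) (hat : 0 < a + t) (hbt : 0 < b - t) :
    mgf logOdds (betaMeasure a b) t = beta (a + t) (b - t) / beta a b := by
  rw [mgf, integral_betaMeasure ha hb]
  simp only [exp_mul_logOdds_mul_betaPDFReal hat hbt]
  rw [integral_const_mul, integral_betaPDFReal hat hbt, mul_one]

theorem log_beta {a b : ℝ} (ha : 0 < a) (hb : 0 < b) :
    Real.log (beta a b)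
      = Real.log (Real.Gamma a) + Real.log (Real.Gamma b) - Real.log (Real.Gamma (a + b)) := by
  have h1 := (Real.Gamma_pos_of_pos ha).ne'
  have h2 := (Real.Gamma_pos_of_pos hb).ne'
  rw [beta, Real.log_div (mul_ne_zero h1 h2) (Real.Gamma_pos_of_pos (add_pos ha hb)).ne',
    Real.log_mul h1 h2]

theorem Ioo_mem_nhds_zero {a b : ℝ} (ha : 0 < a) (hb : 0 < b) : Ioo (-a) b ∈ 𝓝 (0 : ℝ) :=
  Ioo_mem_nhds (by linarith) hb

theorem zero_mem_interior_integrableExpSet_logOdds {a b : ℝ} (ha : 0 < a) (hb : 0 < b) :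
    0 ∈ interior (integrableExpSet logOdds (betaMeasure a b)) := by
  rw [mem_interior_iff_mem_nhds]
  filter_upwards [Ioo_mem_nhds_zero ha hb] with t ht
  exact integrable_exp_mul_logOdds ha hb (by linarith [ht.1]) (by linarith [ht.2])

/-- Tilting by exp(tℓ) moves (a, b) to (a + t, b − t). The sum of the parameters is unchanged, so
Γ(a + b) contributes nothing to the derivative. -/
theorem hasDerivAt_cgf_logOdds {a b t : ℝ} (ha : 0 < a) (hb : 0 < b) (ht : t ∈ Ioo (-a) b) :
    HasDerivAt (cgf logOdds (betaMeasure a b)) (realDigamma (a + t) - realDigamma (b - t)) t := by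
  have hat : 0 < a + t := by linarith [ht.1]
  have hbt : 0 < b - t := by linarith [ht.2]
  have h1 : HasDerivAt (fun u => Real.log (Real.Gamma (a + u))) (realDigamma (a + t)) t :=
    (hasDerivAt_log_Gamma hat).comp_const_add a t
  have h2 : HasDerivAt (fun u => Real.log (Real.Gamma (b - u))) (-realDigamma (b - t)) t :=
    (hasDerivAt_log_Gamma hbt).comp_const_sub b t
  have h3 := ((h1.add h2).sub_const (Real.log (Real.Gamma (a + b)))).sub_const
    (Real.log (beta a b))
  rw [sub_eq_add_neg]
  refine h3.congr_of_eventuallyEq ?_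
  filter_upwards [isOpen_Ioo.mem_nhds ht] with u hu
  have hau : 0 < a + u := by linarith [hu.1]
  have hbu : 0 < b - u := by linarith [hu.2]
  rw [cgf, mgf_logOdds ha hb hau hbu, Real.log_div (beta_pos hau hbu).ne' (beta_pos ha hb).ne',
    log_beta hau hbu]
  simp only [Pi.add_apply, show a + u + (b - u) = a + b by ring]

theorem integral_logOdds {a b : ℝ} (ha : 0 < a) (hb : 0 < b) :
    ∫ p, logOdds p ∂betaMeasure a b = realDigamma a - realDigamma b := by
  have := isProbabilityMeasureBeta ha hb
  have h := deriv_cgf_zero (zero_mem_interior_integrableExpSet_logOdds ha hb)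
  rw [(hasDerivAt_cgf_logOdds ha hb ⟨by linarith, hb⟩).deriv] at h
  simpa using h.symm

theorem memLp_logOdds {a b : ℝ} (ha : 0 < a) (hb : 0 < b) :
    MemLp logOdds 2 (betaMeasure a b) := by
  have := memLp_of_mem_interior_integrableExpSet
    (zero_mem_interior_integrableExpSet_logOdds ha hb) 2
  simpa using this

theorem integral_logOdds_sub_mean_sq {a b : ℝ} (ha : 0 < a) (hb : 0 < b) :
    ∫ p, (logOdds p - (realDigamma a - realDigamma b)) ^ 2 ∂betaMeasure a b
      = realTrigamma a + realTrigamma b := by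
  have := isProbabilityMeasureBeta ha hb
  have h0 : (0 : ℝ) ∈ Ioo (-a) b := ⟨by linarith, hb⟩
  have h := iteratedDeriv_two_cgf_eq_integral (zero_mem_interior_integrableExpSet_logOdds ha hb)
  rw [(hasDerivAt_cgf_logOdds ha hb h0).deriv, iteratedDeriv_succ, iteratedDeriv_one] at h
  simp only [add_zero, sub_zero, zero_mul, Real.exp_zero, mul_one, mgf_zero, div_one] at h
  rw [← h]
  have h1 : HasDerivAt (fun t => realDigamma (a + t)) (realTrigamma (a + 0)) 0 :=
    (hasDerivAt_realDigamma (by simpa using ha)).comp_const_add a 0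
  have h2 : HasDerivAt (fun t => realDigamma (b - t)) (-realTrigamma (b - 0)) 0 :=
    (hasDerivAt_realDigamma (by simpa using hb)).comp_const_sub b 0
  have h3 := h1.sub h2
  rw [add_zero, sub_zero, sub_neg_eq_add] at h3
  refine (h3.congr_of_eventuallyEq ?_).deriv
  filter_upwards [Ioo_mem_nhds_zero ha hb] with t ht
  exact (hasDerivAt_cgf_logOdds ha hb ht).deriv

theorem integral_logOdds_sub_sq {a b : ℝ} (ha : 0 < a) (hb : 0 < b) (c : ℝ) :
    ∫ p, (logOdds p - c) ^ 2 ∂betaMeasure a b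
      = realTrigamma a + realTrigamma b + (realDigamma a - realDigamma b - c) ^ 2 := by
  have := isProbabilityMeasureBeta ha hb
  have hL := memLp_logOdds ha hb
  have hi := hL.integrable (by norm_num)
  set m := realDigamma a - realDigamma b with hm
  have hsq : Integrable (fun p => (logOdds p - m) ^ 2) (betaMeasure a b) :=
    (hL.sub (memLp_const m)).integrable_sq
  have hlin : Integrable (fun p => 2 * (m - c) * (logOdds p - m)) (betaMeasure a b) :=
    (hi.sub (integrable_const m)).const_mul _
  have hsum : Integrable (fun p => (logOdds p - m) ^ 2 + 2 * (m - c) * (logOdds p - m))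
      (betaMeasure a b) := hsq.add hlin
  have e : ∀ p, (logOdds p - c) ^ 2
      = (logOdds p - m) ^ 2 + 2 * (m - c) * (logOdds p - m) + (m - c) ^ 2 := fun p => by ring
  simp only [e]
  rw [integral_add hsum (integrable_const _), integral_add hsq hlin,
    integral_logOdds_sub_mean_sq ha hb, integral_const_mul, integral_sub hi (integrable_const _),
    integral_logOdds ha hb]
  simp [hm]

/-! ### Covariance of p with the log-odds, and Cauchy-Schwarz. -/

theorem beta_add_one_left {a b : ℝ} (ha : 0 < a) (hb : 0 < b) :
    beta (a + 1) b = a / (a + b) * beta a b := by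
  have h1 := (Real.Gamma_pos_of_pos (add_pos ha hb)).ne'
  have h2 := (add_pos ha hb).ne'
  rw [beta, beta, show a + 1 + b = a + b + 1 by ring, Real.Gamma_add_one ha.ne',
    Real.Gamma_add_one h2]
  field_simp

theorem integral_id_mul_betaMeasure {a b : ℝ} (ha : 0 < a) (hb : 0 < b) (h : ℝ → ℝ) :
    ∫ p, p * h p ∂betaMeasure a b = a / (a + b) * ∫ p, h p ∂betaMeasure (a + 1) b := by
  have ha1 : 0 < a + 1 := by linarith
  rw [integral_betaMeasure ha hb, integral_betaMeasure ha1 hb, ← integral_const_mul]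
  refine integral_congr_ae (Eventually.of_forall fun p => ?_)
  have key := rpow_mul_rpow_mul_betaPDFReal (a := a) (b := b) (s := 1) (r := 0) ha1 (by simpa) p
  rw [add_zero, beta_add_one_left ha hb, mul_div_assoc, div_self (beta_pos ha hb).ne', mul_one,
    Real.rpow_one, Real.rpow_zero, mul_one] at key
  simp only
  linear_combination h p * key

theorem integral_id_betaMeasure {a b : ℝ} (ha : 0 < a) (hb : 0 < b) :
    ∫ p, p ∂betaMeasure a b = a / (a + b) := by
  have := isProbabilityMeasureBeta (by linarith : 0 < a + 1) hb
  simpa using integral_id_mul_betaMeasure ha hb fun _ => 1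

theorem memLp_id_betaMeasure {a b : ℝ} (ha : 0 < a) (hb : 0 < b) :
    MemLp (fun p => p) 2 (betaMeasure a b) := by
  have := isProbabilityMeasureBeta ha hb
  refine MemLp.of_bound measurable_id.aestronglyMeasurable 1 ?_
  filter_upwards [ae_betaMeasure_mem_Ioo a b] with p hp
  rw [Real.norm_eq_abs, abs_le]
  exact ⟨by linarith [hp.1], hp.2.le⟩

/-- The factor p shifts a to a + 1, which raises the mean log-odds by 1/a; times the mean a/(a + b),
this is the covariance 1/(a + b). -/
theorem integral_sub_mul_logOdds_sub {a b : ℝ} (ha : 0 < a) (hb : 0 < b) (e c : ℝ) :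
    ∫ p, (p - e) * (logOdds p - c) ∂betaMeasure a b
      = 1 / (a + b) + (a / (a + b) - e) * (realDigamma a - realDigamma b - c) := by
  have := isProbabilityMeasureBeta ha hb
  have hL := memLp_logOdds ha hb
  have hi := hL.integrable (by norm_num)
  have hX := memLp_id_betaMeasure ha hb
  have hXi := hX.integrable (by norm_num)
  have hXL : Integrable (fun p => p * logOdds p) (betaMeasure a b) := hX.integrable_mul hL
  have h1 : Integrable (fun p => p * logOdds p - c * p) (betaMeasure a b) :=
    hXL.sub (hXi.const_mul c)
  have h2 : Integrable (fun p => e * (logOdds p - c)) (betaMeasure a b) :=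
    (hi.sub (integrable_const c)).const_mul e
  have ex : ∀ p, (p - e) * (logOdds p - c) = p * logOdds p - c * p - e * (logOdds p - c) :=
    fun p => by ring
  simp only [ex]
  rw [integral_sub h1 h2,
    integral_sub hXL (hXi.const_mul c), integral_const_mul, integral_const_mul,
    integral_sub hi (integrable_const c), integral_id_mul_betaMeasure ha hb,
    integral_logOdds (by linarith) hb, integral_logOdds ha hb, integral_id_betaMeasure ha hb,
    realDigamma_add_one ha]
  have := (add_pos ha hb).ne'
  simp
  field_simp
  ring

/-- The Cauchy-Schwarz inequality for integrals of real square-integrable functions. -/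
theorem sq_integral_mul_div_le {Ω : Type*} [MeasurableSpace Ω] {μ : Measure Ω} {X Y : Ω → ℝ}
    (hX : MemLp X 2 μ) (hY : MemLp Y 2 μ) (hpos : 0 < ∫ ω, Y ω ^ 2 ∂μ) :
    (∫ ω, X ω * Y ω ∂μ) ^ 2 / ∫ ω, Y ω ^ 2 ∂μ ≤ ∫ ω, X ω ^ 2 ∂μ := by
  set I := ∫ ω, Y ω ^ 2 ∂μ with hI
  set C := ∫ ω, X ω * Y ω ∂μ with hC
  have hXY : Integrable (fun ω => X ω * Y ω) μ := hX.integrable_mul hY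
  have hsub : Integrable (fun ω => X ω ^ 2 - 2 * (C / I) * (X ω * Y ω)) μ :=
    hX.integrable_sq.sub (hXY.const_mul _)
  have h0 : 0 ≤ ∫ ω, (X ω - C / I * Y ω) ^ 2 ∂μ := integral_nonneg fun ω => sq_nonneg _
  have ex : ∀ ω, (X ω - C / I * Y ω) ^ 2
      = X ω ^ 2 - 2 * (C / I) * (X ω * Y ω) + (C / I) ^ 2 * Y ω ^ 2 := fun ω => by ring
  simp only [ex] at h0
  rw [integral_add hsub (hY.integrable_sq.const_mul _),
    integral_sub hX.integrable_sq (hXY.const_mul _), integral_const_mul, integral_const_mul,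
    ← hI, ← hC] at h0
  have : C ^ 2 / I = 2 * (C / I) * C - (C / I) ^ 2 * I := by field_simp; ring
  linarith

/-! ### Closed forms of the weighted functionals of the Beta posterior -/

/-- The difference between the mean log-odds under the Beta distributions with parameters
`(a + s, b + r)` and `(a, b)`. -/
def digammaShift (a b s r : ℝ) : ℝ :=
  realDigamma (a + s) - realDigamma (b + r) - (realDigamma a - realDigamma b)

section

variable {n : ℕ} {θ γ k : ℝ}

theorem peakWeight_mul_posteriorPDF (ha : 0 < n * θ + 1) (hb : 0 < n * (1 - θ) + 1)
    (hs : 0 ≤ γ * k) (hr : 0 ≤ (1 - γ) * k) (p : ℝ) :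
    peakWeight γ k p * posteriorPDF n θ p
      = beta (n * θ + 1 + γ * k) (n * (1 - θ) + 1 + (1 - γ) * k)
          / beta (n * θ + 1) (n * (1 - θ) + 1)
        * betaPDFReal (n * θ + 1 + γ * k) (n * (1 - θ) + 1 + (1 - γ) * k) p :=
  rpow_mul_rpow_mul_betaPDFReal (by linarith) (by linarith) p

theorem weightNorm_posterior (ha : 0 < n * θ + 1) (hb : 0 < n * (1 - θ) + 1)
    (hs : 0 ≤ γ * k) (hr : 0 ≤ (1 - γ) * k) :
    weightNorm (posteriorPDF n) (peakWeight γ k) θ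
      = beta (n * θ + 1 + γ * k) (n * (1 - θ) + 1 + (1 - γ) * k)
          / beta (n * θ + 1) (n * (1 - θ) + 1) := by
  unfold weightNorm
  simp only [peakWeight_mul_posteriorPDF ha hb hs hr]
  rw [integral_const_mul, integral_betaPDFReal (by linarith) (by linarith), mul_one]

theorem integral_mul_weightFun_mul_posterior (ha : 0 < n * θ + 1) (hb : 0 < n * (1 - θ) + 1)
    (hs : 0 ≤ γ * k) (hr : 0 ≤ (1 - γ) * k) (h : ℝ → ℝ) :
    ∫ p, h p * weightFun (posteriorPDF n) (peakWeight γ k) θ p * posteriorPDF n θ p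
      = ∫ p, h p ∂betaMeasure (n * θ + 1 + γ * k) (n * (1 - θ) + 1 + (1 - γ) * k) := by
  have hA : 0 < n * θ + 1 + γ * k := by linarith
  have hB : 0 < n * (1 - θ) + 1 + (1 - γ) * k := by linarith
  rw [integral_betaMeasure hA hB]
  refine integral_congr_ae (Eventually.of_forall fun p => ?_)
  have h1 := beta_pos hA hB
  have h2 := beta_pos ha hb
  simp only [weightFun, weightNorm_posterior ha hb hs hr]
  rw [mul_assoc, div_mul_eq_mul_div, peakWeight_mul_posteriorPDF ha hb hs hr,
    mul_div_cancel_left₀ _ (div_pos h1 h2).ne']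

theorem classicalMean_posterior (ha : 0 < n * θ + 1) (hb : 0 < n * (1 - θ) + 1) :
    classicalMean (posteriorPDF n) θ = (n * θ + 1) / (n + 2) := by
  have := integral_id_betaMeasure ha hb
  rw [integral_betaMeasure ha hb] at this
  rw [classicalMean, show (n : ℝ) + 2 = n * θ + 1 + (n * (1 - θ) + 1) by ring]
  exact this

theorem weightedMean_posterior (ha : 0 < n * θ + 1) (hb : 0 < n * (1 - θ) + 1)
    (hs : 0 ≤ γ * k) (hr : 0 ≤ (1 - γ) * k) :
    weightedMean (posteriorPDF n) (peakWeight γ k) θ = (n * θ + 1 + γ * k) / (n + 2 + k) := by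
  rw [weightedMean, integral_mul_weightFun_mul_posterior ha hb hs hr fun p => p,
    integral_id_betaMeasure (by linarith) (by linarith)]
  congr 1
  ring

theorem eventually_shape_pos (ha : 0 < n * θ + 1) (hb : 0 < n * (1 - θ) + 1) :
    ∀ᶠ t : ℝ in 𝓝 θ, 0 < n * t + 1 ∧ 0 < n * (1 - t) + 1 := by
  have h1 : Continuous fun t : ℝ => n * t + 1 := by fun_prop
  have h2 : Continuous fun t : ℝ => n * (1 - t) + 1 := by fun_prop
  exact (h1.continuousAt.eventually (lt_mem_nhds ha)).and
    (h2.continuousAt.eventually (lt_mem_nhds hb))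

theorem deriv_weightedMean_posterior (ha : 0 < n * θ + 1) (hb : 0 < n * (1 - θ) + 1)
    (hs : 0 ≤ γ * k) (hr : 0 ≤ (1 - γ) * k) :
    deriv (weightedMean (posteriorPDF n) (peakWeight γ k)) θ = n / (n + 2 + k) := by
  have h : HasDerivAt (fun t : ℝ => (n * t + 1 + γ * k) / (n + 2 + k)) (n * 1 / (n + 2 + k)) θ :=
    ((((hasDerivAt_id θ).const_mul (n : ℝ)).add_const 1).add_const (γ * k)).div_const _
  rw [mul_one] at h
  refine (h.congr_of_eventuallyEq ?_).deriv
  filter_upwards [eventually_shape_pos ha hb] with t ht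
  exact weightedMean_posterior ht.1 ht.2 hs hr

theorem hasDerivAt_log_beta_shape {s r : ℝ} (ha : 0 < n * θ + 1 + s)
    (hb : 0 < n * (1 - θ) + 1 + r) :
    HasDerivAt (fun t : ℝ => Real.log (Real.Gamma (n * t + 1 + s))
        + Real.log (Real.Gamma (n * (1 - t) + 1 + r)))
      (n * (realDigamma (n * θ + 1 + s) - realDigamma (n * (1 - θ) + 1 + r))) θ := by
  have h1 : HasDerivAt (fun t : ℝ => n * t + 1 + s) (n * 1) θ :=
    (((hasDerivAt_id θ).const_mul (n : ℝ)).add_const 1).add_const s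
  have h2 : HasDerivAt (fun t : ℝ => n * (1 - t) + 1 + r) (n * -1) θ :=
    ((((hasDerivAt_id θ).const_sub 1).const_mul (n : ℝ)).add_const 1).add_const r
  refine (((hasDerivAt_log_Gamma ha).comp θ h1).add
    ((hasDerivAt_log_Gamma hb).comp θ h2)).congr_deriv ?_
  ring

theorem logDeriv_weightNorm_posterior (ha : 0 < n * θ + 1) (hb : 0 < n * (1 - θ) + 1)
    (hs : 0 ≤ γ * k) (hr : 0 ≤ (1 - γ) * k) :
    deriv (weightNorm (posteriorPDF n) (peakWeight γ k)) θ
        / weightNorm (posteriorPDF n) (peakWeight γ k) θ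
      = n * digammaShift (n * θ + 1) (n * (1 - θ) + 1) (γ * k) ((1 - γ) * k) := by
  have h1 := hasDerivAt_log_beta_shape (n := n) (θ := θ) (s := γ * k) (r := (1 - γ) * k)
    (by linarith) (by linarith)
  have h2 := hasDerivAt_log_beta_shape (n := n) (θ := θ) (s := 0) (r := 0)
    (by linarith) (by linarith)
  simp only [add_zero] at h2
  -- The parameter sums n + 2 + k and n + 2 do not involve θ, so their Gamma values are constants
  -- here.
  have h3 := ((h1.sub h2).sub_const
    (Real.log (Real.Gamma (n + 2 + k)) - Real.log (Real.Gamma (n + 2)))).exp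
  have h4 : weightNorm (posteriorPDF n) (peakWeight γ k) =ᶠ[𝓝 θ] fun t =>
      Real.exp (Real.log (Real.Gamma (n * t + 1 + γ * k))
        + Real.log (Real.Gamma (n * (1 - t) + 1 + (1 - γ) * k))
        - (Real.log (Real.Gamma (n * t + 1)) + Real.log (Real.Gamma (n * (1 - t) + 1)))
        - (Real.log (Real.Gamma (n + 2 + k)) - Real.log (Real.Gamma (n + 2)))) := by
    filter_upwards [eventually_shape_pos ha hb] with t ht
    have hA : 0 < n * t + 1 + γ * k := by linarith [ht.1]
    have hB : 0 < n * (1 - t) + 1 + (1 - γ) * k := by linarith [ht.2]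
    have e1 := log_beta hA hB
    have e2 := log_beta ht.1 ht.2
    rw [show n * t + 1 + γ * k + (n * (1 - t) + 1 + (1 - γ) * k) = n + 2 + k by ring] at e1
    rw [show n * t + 1 + (n * (1 - t) + 1) = (n : ℝ) + 2 by ring] at e2
    rw [weightNorm_posterior ht.1 ht.2 hs hr,
      ← Real.exp_log (div_pos (beta_pos hA hB) (beta_pos ht.1 ht.2)),
      Real.log_div (beta_pos hA hB).ne' (beta_pos ht.1 ht.2).ne', e1, e2]
    congr 1
    ring
  rw [(h3.congr_of_eventuallyEq h4).deriv, h4.self_of_nhds, mul_comm, mul_div_assoc]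
  simp only [Pi.sub_apply]
  rw [div_self (Real.exp_ne_zero _), digammaShift]
  ring

theorem deriv_log_posteriorPDF (ha : 0 < n * θ + 1) (hb : 0 < n * (1 - θ) + 1) {p : ℝ}
    (hp : 0 < p ∧ p < 1) :
    deriv (fun t => Real.log (posteriorPDF n t p)) θ
      = n * (logOdds p - (realDigamma (n * θ + 1) - realDigamma (n * (1 - θ) + 1))) := by
  have hp1 : 0 < 1 - p := by linarith [hp.2]
  have h2 := hasDerivAt_log_beta_shape (n := n) (θ := θ) (s := 0) (r := 0)
    (by linarith) (by linarith)
  simp only [add_zero] at h2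
  have h1 : HasDerivAt (fun t : ℝ => n * t * Real.log p) (n * 1 * Real.log p) θ :=
    ((hasDerivAt_id θ).const_mul (n : ℝ)).mul_const _
  have h3 : HasDerivAt (fun t : ℝ => n * (1 - t) * Real.log (1 - p))
      (n * -1 * Real.log (1 - p)) θ :=
    (((hasDerivAt_id θ).const_sub 1).const_mul (n : ℝ)).mul_const _
  have h4 := ((h1.add h3).sub h2).add_const (Real.log (Real.Gamma (n + 2)))
  have h5 : (fun t => Real.log (posteriorPDF n t p)) =ᶠ[𝓝 θ] fun t =>
      n * t * Real.log p + n * (1 - t) * Real.log (1 - p)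
        - (Real.log (Real.Gamma (n * t + 1)) + Real.log (Real.Gamma (n * (1 - t) + 1)))
        + Real.log (Real.Gamma (n + 2)) := by
    filter_upwards [eventually_shape_pos ha hb] with t ht
    have e2 := log_beta ht.1 ht.2
    rw [show n * t + 1 + (n * (1 - t) + 1) = (n : ℝ) + 2 by ring] at e2
    rw [posteriorPDF, betaPDFReal, if_pos hp, add_sub_cancel_right, add_sub_cancel_right,
      Real.log_mul (mul_ne_zero (one_div_ne_zero (beta_pos ht.1 ht.2).ne')
        (Real.rpow_pos_of_pos hp.1 _).ne') (Real.rpow_pos_of_pos hp1 _).ne',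
      Real.log_mul (one_div_ne_zero (beta_pos ht.1 ht.2).ne') (Real.rpow_pos_of_pos hp.1 _).ne',
      one_div, Real.log_inv, Real.log_rpow hp.1, Real.log_rpow hp1, e2]
    ring
  rw [(h4.congr_of_eventuallyEq h5).deriv, logOdds]
  ring

theorem weightedFisher_posterior_eq_integral (ha : 0 < n * θ + 1) (hb : 0 < n * (1 - θ) + 1)
    (hs : 0 ≤ γ * k) (hr : 0 ≤ (1 - γ) * k) :
    weightedFisher (posteriorPDF n) (peakWeight γ k) θ
      = (n : ℝ) ^ 2
        * ∫ p, (logOdds p - (realDigamma (n * θ + 1) - realDigamma (n * (1 - θ) + 1))) ^ 2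
          ∂betaMeasure (n * θ + 1 + γ * k) (n * (1 - θ) + 1 + (1 - γ) * k) := by
  rw [weightedFisher, integral_mul_weightFun_mul_posterior ha hb hs hr fun p =>
    (deriv (fun t => Real.log (posteriorPDF n t p)) θ) ^ 2, ← integral_const_mul]
  -- The score formula is available only for 0 < p < 1, which is almost everywhere for the Beta
  -- measure.
  refine integral_congr_ae ?_
  filter_upwards [ae_betaMeasure_mem_Ioo _ _] with p hp
  rw [deriv_log_posteriorPDF ha hb hp, mul_pow]

theorem raoCramerBound_posterior (hn : 1 ≤ n) (ha : 0 < n * θ + 1) (hb : 0 < n * (1 - θ) + 1)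
    (hs : 0 ≤ γ * k) (hr : 0 ≤ (1 - γ) * k) :
    raoCramerBound (posteriorPDF n) (peakWeight γ k) θ
      = (1 / (n + 2 + k) - digammaShift (n * θ + 1) (n * (1 - θ) + 1) (γ * k) ((1 - γ) * k)
          * ((n * θ + 1) / (n + 2) - (n * θ + 1 + γ * k) / (n + 2 + k))) ^ 2
        / (realTrigamma (n * θ + 1 + γ * k) + realTrigamma (n * (1 - θ) + 1 + (1 - γ) * k)
          + digammaShift (n * θ + 1) (n * (1 - θ) + 1) (γ * k) ((1 - γ) * k) ^ 2) := by
  have hn' : (n : ℝ) ^ 2 ≠ 0 := by positivity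
  rw [raoCramerBound, deriv_weightedMean_posterior ha hb hs hr,
    logDeriv_weightNorm_posterior ha hb hs hr, classicalMean_posterior ha hb,
    weightedMean_posterior ha hb hs hr, weightedFisher_posterior_eq_integral ha hb hs hr,
    integral_logOdds_sub_sq (by linarith) (by linarith)]
  symm
  rw [← mul_div_mul_left _ _ hn']
  congr 1
  ring

theorem raoCramerBound_posterior_le_weightedVariance (hn : 1 ≤ n) (ha : 0 < n * θ + 1)
    (hb : 0 < n * (1 - θ) + 1) (hs : 0 ≤ γ * k) (hr : 0 ≤ (1 - γ) * k) :
    raoCramerBound (posteriorPDF n) (peakWeight γ k) θ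
      ≤ weightedVariance (posteriorPDF n) (peakWeight γ k) θ := by
  have hA : 0 < n * θ + 1 + γ * k := by linarith
  have hB : 0 < n * (1 - θ) + 1 + (1 - γ) * k := by linarith
  have := isProbabilityMeasureBeta hA hB
  rw [raoCramerBound_posterior hn ha hb hs hr, weightedVariance,
    integral_mul_weightFun_mul_posterior ha hb hs hr fun p =>
      (p - classicalMean (posteriorPDF n) θ) ^ 2, classicalMean_posterior ha hb]
  set c := realDigamma (n * θ + 1) - realDigamma (n * (1 - θ) + 1) with hc
  have hI := integral_logOdds_sub_sq hA hB c
  have hpos : 0 < realTrigamma (n * θ + 1 + γ * k)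
      + realTrigamma (n * (1 - θ) + 1 + (1 - γ) * k)
      + (realDigamma (n * θ + 1 + γ * k) - realDigamma (n * (1 - θ) + 1 + (1 - γ) * k) - c) ^ 2 := by
    have := realTrigamma_pos hA
    have := realTrigamma_pos hB
    positivity
  have key := sq_integral_mul_div_le
    (X := fun p => p - (n * θ + 1) / (n + 2)) (Y := fun p => logOdds p - c)
    ((memLp_id_betaMeasure hA hB).sub (memLp_const _))
    ((memLp_logOdds hA hB).sub (memLp_const c)) (by rw [hI]; exact hpos)
  rw [hI, integral_sub_mul_logOdds_sub hA hB, show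
    n * θ + 1 + γ * k + (n * (1 - θ) + 1 + (1 - γ) * k) = n + 2 + k by ring] at key
  refine le_trans (le_of_eq ?_) key
  rw [digammaShift]
  congr 1
  ring

end

/-! ### Two-term expansions in a null sequence -/

/-- `F n = c + d n * u n + O(u n ^ 2)` for a null sequence `u` and bounded coefficients `d`. -/
structure TwoTerm (u F : ℕ → ℝ) (c : ℝ) (d : ℕ → ℝ) : Prop where
  null : Tendsto u atTop (𝓝 0)
  bdd : d =O[atTop] fun _ => (1 : ℝ)
  err : (fun n => F n - (c + d n * u n)) =O[atTop] fun n => u n ^ 2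

namespace TwoTerm

variable {u F G : ℕ → ℝ} {c c' : ℝ} {d d' : ℕ → ℝ}

theorem congr (h : TwoTerm u F c d) (hF : ∀ᶠ n in atTop, F n = G n) (hc : c = c')
    (hd : ∀ n, d n = d' n) : TwoTerm u G c' d' := by
  obtain rfl := hc
  obtain rfl := funext hd
  refine ⟨h.null, h.bdd, h.err.congr' ?_ EventuallyEq.rfl⟩
  filter_upwards [hF] with n hn
  rw [hn]

theorem isBigO_mul_null (h : TwoTerm u F c d) : (fun n => d n * u n) =O[atTop] u := by
  simpa using h.bdd.mul (isBigO_refl u atTop)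

theorem isBigO_sq_null (hu : Tendsto u atTop (𝓝 0)) :
    (fun n => u n ^ 2) =O[atTop] u := by
  have := (hu.isBigO_one ℝ).mul (isBigO_refl u atTop)
  simpa [sq] using this

theorem isBigO_sub (h : TwoTerm u F c d) : (fun n => F n - c) =O[atTop] u := by
  refine ((h.err.trans (isBigO_sq_null h.null)).add h.isBigO_mul_null).congr_left fun n => ?_
  ring

theorem tendsto (h : TwoTerm u F c d) : Tendsto F atTop (𝓝 c) := by
  have := (h.isBigO_sub.trans_tendsto h.null).add_const c
  simpa using this

theorem isBigO_one (h : TwoTerm u F c d) : F =O[atTop] fun _ => (1 : ℝ) :=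
  h.tendsto.isBigO_one ℝ

theorem const (hu : Tendsto u atTop (𝓝 0)) (c : ℝ) : TwoTerm u (fun _ => c) c (fun _ => 0) :=
  ⟨hu, isBigO_const_const _ one_ne_zero _, by simpa using isBigO_zero _ _⟩

theorem of_isBigO (hu : Tendsto u atTop (𝓝 0)) (hF : F =O[atTop] fun n => u n ^ 2) :
    TwoTerm u F 0 (fun _ => 0) :=
  ⟨hu, isBigO_const_const _ one_ne_zero _, by simpa using hF⟩

theorem linear (hu : Tendsto u atTop (𝓝 0)) (hd : d =O[atTop] fun _ => (1 : ℝ)) (c : ℝ) :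
    TwoTerm u (fun n => c + d n * u n) c d :=
  ⟨hu, hd, by simpa using isBigO_zero _ _⟩

theorem add (hF : TwoTerm u F c d) (hG : TwoTerm u G c' d') :
    TwoTerm u (fun n => F n + G n) (c + c') (fun n => d n + d' n) :=
  ⟨hF.null, hF.bdd.add hG.bdd, (hF.err.add hG.err).congr_left fun n => by ring⟩

theorem sub (hF : TwoTerm u F c d) (hG : TwoTerm u G c' d') :
    TwoTerm u (fun n => F n - G n) (c - c') (fun n => d n - d' n) :=
  ⟨hF.null, hF.bdd.sub hG.bdd, (hF.err.sub hG.err).congr_left fun n => by ring⟩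

theorem mul (hF : TwoTerm u F c d) (hG : TwoTerm u G c' d') :
    TwoTerm u (fun n => F n * G n) (c * c') (fun n => c * d' n + c' * d n) := by
  refine ⟨hF.null, (hG.bdd.const_mul_left c).add (hF.bdd.const_mul_left c'), ?_⟩
  have h1 : (fun n => (F n - (c + d n * u n)) * G n) =O[atTop] fun n => u n ^ 2 := by
    simpa using hF.err.mul hG.isBigO_one
  have h2 : (fun n => c * (G n - (c' + d' n * u n))) =O[atTop] fun n => u n ^ 2 :=
    hG.err.const_mul_left c
  have h3 : (fun n => d n * u n * (G n - c')) =O[atTop] fun n => u n ^ 2 := by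
    simpa [sq] using hF.isBigO_mul_null.mul hG.isBigO_sub
  exact ((h1.add h2).add h3).congr_left fun n => by ring

theorem const_mul (hF : TwoTerm u F c d) (k : ℝ) :
    TwoTerm u (fun n => k * F n) (k * c) (fun n => k * d n) :=
  ⟨hF.null, hF.bdd.const_mul_left k, (hF.err.const_mul_left k).congr_left fun n => by ring⟩

theorem null_mul (hF : TwoTerm u F c d) :
    TwoTerm u (fun n => u n * F n) 0 (fun _ => c) := by
  refine ⟨hF.null, isBigO_const_const _ one_ne_zero _, ?_⟩
  have h : (fun n => u n * (F n - c)) =O[atTop] fun n => u n ^ 2 := by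
    simpa [sq] using (isBigO_refl u atTop).mul hF.isBigO_sub
  exact h.congr_left fun n => by ring

theorem sq (hF : TwoTerm u F c d) :
    TwoTerm u (fun n => F n ^ 2) (c ^ 2) (fun n => 2 * c * d n) :=
  (hF.mul hF).congr (Eventually.of_forall fun n => by ring) (by ring) fun n => by ring

/-- Both factors are O(u), so their errors enter the product at order u³; dividing by u still leaves
O(u²), and no second-order coefficients are needed. -/
theorem inv_null_mul_mul (hF : TwoTerm u F 0 d) (hG : TwoTerm u G 0 d')
    (hu : ∀ᶠ n in atTop, u n ≠ 0) :
    TwoTerm u (fun n => (u n)⁻¹ * (F n * G n)) 0 (fun n => d n * d' n) := by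
  refine ⟨hF.null, by simpa using hF.bdd.mul hG.bdd, ?_⟩
  have e1 := hF.err
  have e2 := hG.err
  have s := hG.isBigO_sub
  simp only [zero_add, sub_zero] at e1 e2 s
  have h1 : (fun n => (F n - d n * u n) * G n) =O[atTop] fun n => u n ^ 2 * u n := e1.mul s
  have h2 : (fun n => (d n * u n) * (G n - d' n * u n)) =O[atTop] fun n => u n ^ 2 * u n :=
    (hF.isBigO_mul_null.mul e2).congr_right fun n => by ring
  have h3 := (isBigO_refl (fun n => (u n)⁻¹) atTop).mul (h1.add h2)
  refine h3.congr' ?_ ?_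
  · filter_upwards [hu] with n hn
    field_simp
    ring
  · filter_upwards [hu] with n hn
    field_simp

/-- Composition with a function that is approximated to second order by its tangent. -/
theorem comp {φ : ℝ → ℝ} {m : ℝ} (hF : TwoTerm u F c d)
    (hφ : (fun y => φ y - φ c - m * (y - c)) =O[𝓝 c] fun y => (y - c) ^ 2) :
    TwoTerm u (fun n => φ (F n)) (φ c) (fun n => m * d n) := by
  refine ⟨hF.null, hF.bdd.const_mul_left m, ?_⟩
  have h1 : (fun n => φ (F n) - φ c - m * (F n - c)) =O[atTop] fun n => u n ^ 2 :=
    (hφ.comp_tendsto hF.tendsto).trans (hF.isBigO_sub.pow 2)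
  exact (h1.add (hF.err.const_mul_left m)).congr_left fun n => by ring

theorem inv (hF : TwoTerm u F c d) (hc : c ≠ 0) :
    TwoTerm u (fun n => (F n)⁻¹) c⁻¹ (fun n => -(c ^ 2)⁻¹ * d n) := by
  refine hF.comp ?_
  have hev : ∀ᶠ y in 𝓝 c, y ≠ 0 := isOpen_ne.mem_nhds hc
  have hb : (fun y : ℝ => (c ^ 2 * y)⁻¹) =O[𝓝 c] fun _ => (1 : ℝ) := by
    have : ContinuousAt (fun y : ℝ => (c ^ 2 * y)⁻¹) c :=
      ContinuousAt.inv₀ (by fun_prop) (by positivity)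
    exact this.tendsto.isBigO_one ℝ
  have h := hb.mul (isBigO_refl (fun y : ℝ => (y - c) ^ 2) (𝓝 c))
  simp only [one_mul] at h
  refine h.congr' ?_ EventuallyEq.rfl
  filter_upwards [hev] with y hy
  field_simp
  ring

theorem div (hF : TwoTerm u F c d) (hG : TwoTerm u G c' d') (hc : c' ≠ 0) :
    TwoTerm u (fun n => F n / G n) (c / c') (fun n => (d n * c' - c * d' n) / c' ^ 2) :=
  (hF.mul (hG.inv hc)).congr (Eventually.of_forall fun n => by ring) (by ring) fun n => by
    field_simp
    ring

theorem log (hF : TwoTerm u F c d) (hc : 0 < c) :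
    TwoTerm u (fun n => Real.log (F n)) (Real.log c) (fun n => c⁻¹ * d n) := by
  refine hF.comp ?_
  refine IsBigO.of_bound (2 / c ^ 2) ?_
  filter_upwards [lt_mem_nhds (half_lt_self hc)] with y hy
  have hy0 : 0 < y := by linarith
  have e : Real.log y - Real.log c = Real.log (y / c) := (Real.log_div hy0.ne' hc.ne').symm
  have h1 := Real.log_le_sub_one_of_pos (div_pos hy0 hc)
  have h2 := Real.one_sub_inv_le_log_of_pos (div_pos hy0 hc)
  have e1 : c⁻¹ * (y - c) = y / c - 1 := by field_simp
  rw [e, e1, Real.norm_eq_abs, Real.norm_eq_abs, abs_of_nonpos (by linarith),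
    abs_of_nonneg (sq_nonneg _)]
  -- The gap in 1 − 1/t ≤ log t ≤ t − 1 at t = y/c is quadratic in y − c.
  have h3 : y / c - 1 - (1 - (y / c)⁻¹) = 1 / (c * y) * (y - c) ^ 2 := by field_simp
  have h4 : 1 / (c * y) ≤ 2 / c ^ 2 := by
    rw [div_le_div_iff₀ (by positivity) (by positivity)]
    nlinarith
  have h5 := mul_le_mul_of_nonneg_right h4 (sq_nonneg (y - c))
  linarith

end TwoTerm

theorem tendsto_one_div_natCast : Tendsto (fun n : ℕ => 1 / (n : ℝ)) atTop (𝓝 0) :=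
  tendsto_one_div_atTop_nhds_zero_nat

theorem eventually_natCast_pos : ∀ᶠ n : ℕ in atTop, 0 < (n : ℝ) := by
  filter_upwards [eventually_gt_atTop 0] with n hn
  exact_mod_cast hn

/-! ### Expansions of the digamma and trigamma functions -/

theorem isBigO_realDigamma_mul {Y : ℕ → ℝ} {c : ℝ} (hc : 0 < c) (hY : Tendsto Y atTop (𝓝 c)) :
    (fun n : ℕ => realDigamma (n * Y n) - Real.log n - (Real.log (Y n) - 1 / n * (1 / 2 * (Y n)⁻¹)))
      =O[atTop] fun n : ℕ => (1 / (n : ℝ)) ^ 2 := by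
  -- This is n² · 1/(8X²) at X = nc/2, since eventually Y n > c/2.
  refine IsBigO.of_bound (1 / (2 * c ^ 2)) ?_
  filter_upwards [hY.eventually (lt_mem_nhds (half_lt_self hc)), eventually_natCast_pos]
    with n hn hn0
  have hY0 : 0 < Y n := by linarith
  have hX := mul_pos hn0 hY0
  have h1 := realDigamma_upper hX
  have h2 := realDigamma_lower hX
  rw [Real.log_mul hn0.ne' hY0.ne'] at h1 h2
  have e1 : 1 / (2 * (n * Y n)) = 1 / n * (1 / 2 * (Y n)⁻¹) := by field_simp
  have e2 : 1 / (8 * (n * Y n) ^ 2) ≤ 1 / (2 * c ^ 2) * (1 / (n : ℝ)) ^ 2 := by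
    rw [show 1 / (2 * c ^ 2) * (1 / (n : ℝ)) ^ 2 = 1 / (8 * (n * (c / 2)) ^ 2) by field_simp; ring]
    gcongr
  rw [e1] at h1 h2
  rw [Real.norm_eq_abs, Real.norm_eq_abs, abs_of_nonneg (sq_nonneg (1 / (n : ℝ))), abs_le]
  constructor <;> linarith [(by positivity : 0 ≤ 1 / (2 * c ^ 2) * (1 / (n : ℝ)) ^ 2)]

theorem isBigO_realTrigamma_mul {Y : ℕ → ℝ} {c : ℝ} (hc : 0 < c) (hY : Tendsto Y atTop (𝓝 c)) :
    (fun n : ℕ => n * realTrigamma (n * Y n) - ((Y n)⁻¹ + 1 / n * (1 / 2 * (Y n)⁻¹ ^ 2)))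
      =O[atTop] fun n : ℕ => (1 / (n : ℝ)) ^ 2 := by
  refine IsBigO.of_bound (4 / (3 * c ^ 3)) ?_
  filter_upwards [hY.eventually (lt_mem_nhds (half_lt_self hc)), eventually_natCast_pos]
    with n hn hn0
  have hY0 : 0 < Y n := by linarith
  have hX := mul_pos hn0 hY0
  have h1 := mul_le_mul_of_nonneg_left (realTrigamma_lower hX) hn0.le
  have h2 := mul_le_mul_of_nonneg_left (realTrigamma_upper hX) hn0.le
  have e1 : n * (1 / (n * Y n) + 1 / (2 * (n * Y n) ^ 2))
      = (Y n)⁻¹ + 1 / n * (1 / 2 * (Y n)⁻¹ ^ 2) := by field_simp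
  have e2 : n * (1 / (6 * (n * Y n) ^ 3)) ≤ 4 / (3 * c ^ 3) * (1 / (n : ℝ)) ^ 2 := by
    rw [show 4 / (3 * c ^ 3) * (1 / (n : ℝ)) ^ 2 = n * (1 / (6 * (n * (c / 2)) ^ 3)) by
      field_simp; ring]
    gcongr
  rw [mul_add, e1] at h2
  rw [e1] at h1
  rw [Real.norm_eq_abs, Real.norm_eq_abs, abs_of_nonneg (sq_nonneg (1 / (n : ℝ))), abs_le]
  constructor <;> linarith [(by positivity : 0 ≤ 4 / (3 * c ^ 3) * (1 / (n : ℝ)) ^ 2)]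

section

variable {Y : ℕ → ℝ} {c : ℝ} {d : ℕ → ℝ}

theorem TwoTerm.realDigamma_mul (hY : TwoTerm (fun n : ℕ => 1 / (n : ℝ)) Y c d) (hc : 0 < c) :
    TwoTerm (fun n : ℕ => 1 / (n : ℝ)) (fun n => realDigamma (n * Y n) - Real.log n)
      (Real.log c) (fun n => (d n - 1 / 2) / c) :=
  (((hY.log hc).sub ((hY.inv hc.ne').const_mul (1 / 2)).null_mul).add
    (.of_isBigO hY.null (isBigO_realDigamma_mul hc hY.tendsto))).congr
    (Eventually.of_forall fun n => by ring) (by ring) fun n => by field_simp; ring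

theorem TwoTerm.realTrigamma_mul (hY : TwoTerm (fun n : ℕ => 1 / (n : ℝ)) Y c d) (hc : 0 < c) :
    TwoTerm (fun n : ℕ => 1 / (n : ℝ)) (fun n => n * realTrigamma (n * Y n))
      (1 / c) (fun n => (1 / 2 - d n) / c ^ 2) :=
  (((hY.inv hc.ne').add ((hY.inv hc.ne').sq.const_mul (1 / 2)).null_mul).add
    (.of_isBigO hY.null (isBigO_realTrigamma_mul hc hY.tendsto))).congr
    (Eventually.of_forall fun n => by ring) (by ring) fun n => by field_simp; ring

/-- Expansion of the digamma shift for parameters growing linearly in `n`. -/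
theorem twoTerm_digammaShift {Z Y' Z' : ℕ → ℝ} {b c' b' : ℝ} {e d' e' : ℕ → ℝ}
    (hY : TwoTerm (fun n : ℕ => 1 / (n : ℝ)) Y c d) (hc : 0 < c)
    (hZ : TwoTerm (fun n : ℕ => 1 / (n : ℝ)) Z b e) (hb : 0 < b)
    (hY' : TwoTerm (fun n : ℕ => 1 / (n : ℝ)) Y' c' d') (hc' : 0 < c')
    (hZ' : TwoTerm (fun n : ℕ => 1 / (n : ℝ)) Z' b' e') (hb' : 0 < b') :
    TwoTerm (fun n : ℕ => 1 / (n : ℝ))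
      (fun n => digammaShift (n * Y n) (n * Z n) (n * (Y' n - Y n)) (n * (Z' n - Z n)))
      (Real.log c' - Real.log b' - (Real.log c - Real.log b))
      (fun n => (d' n - 1 / 2) / c' - (e' n - 1 / 2) / b'
        - ((d n - 1 / 2) / c - (e n - 1 / 2) / b)) :=
  (((hY'.realDigamma_mul hc').sub (hZ'.realDigamma_mul hb')).sub
    ((hY.realDigamma_mul hc).sub (hZ.realDigamma_mul hb))).congr
    (Eventually.of_forall fun n => by simp only [digammaShift]; ring_nf) rfl fun n => rfl

end

/-! ### Expansions at the scale `1 / √n` -/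

theorem tendsto_one_div_sqrt_natCast : Tendsto (fun n : ℕ => 1 / √(n : ℝ)) atTop (𝓝 0) :=
  tendsto_const_nhds.div_atTop (Real.tendsto_sqrt_atTop.comp tendsto_natCast_atTop_atTop)

theorem one_div_sqrt_sq (n : ℕ) : (1 / √(n : ℝ)) ^ 2 = 1 / n := by
  rw [div_pow, Real.sq_sqrt n.cast_nonneg, one_pow]

theorem isBigO_log_one_add_cubic :
    (fun t : ℝ => Real.log (1 + t) - (t - t ^ 2 / 2)) =O[𝓝 0] fun t => t ^ 3 := by
  refine IsBigO.of_bound 2 ?_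
  have hev : ∀ᶠ t : ℝ in 𝓝 0, |t| < 1 / 2 :=
    (continuous_abs.tendsto' (0 : ℝ) 0 abs_zero).eventually (gt_mem_nhds (by norm_num))
  filter_upwards [hev] with t ht
  have h := Real.abs_log_sub_add_sum_range_le (x := -t) (by rw [abs_neg]; linarith) 2
  rw [Finset.sum_range_succ, Finset.sum_range_one, abs_neg] at h
  have e : Real.log (1 + t) - (t - t ^ 2 / 2)
      = (-t) ^ (0 + 1) / ((0 : ℕ) + 1) + (-t) ^ (1 + 1) / ((1 : ℕ) + 1) + Real.log (1 - -t) := by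
    push_cast
    rw [sub_neg_eq_add]
    ring
  rw [e, Real.norm_eq_abs, Real.norm_eq_abs, abs_pow]
  refine h.trans ?_
  rw [div_le_iff₀ (by linarith)]
  rw [show 2 + 1 = 3 from rfl]
  nlinarith [pow_nonneg (abs_nonneg t) 3, mul_nonneg (pow_nonneg (abs_nonneg t) 3)
    (by linarith : 0 ≤ 1 - 2 * |t|)]

/-- Subtracting two expansions of the logarithm and dividing by u would lose an order. Instead log(1
+ gu/Y) is expanded with cubic error, which leaves O(u²) after the division. -/
theorem TwoTerm.inv_null_mul_log_sub_log {u Y : ℕ → ℝ} {c : ℝ} {d : ℕ → ℝ}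
    (hY : TwoTerm u Y c d) (hc : 0 < c) (g : ℝ) (hu : ∀ᶠ n in atTop, u n ≠ 0) :
    TwoTerm u (fun n => (u n)⁻¹ * (Real.log (Y n + g * u n) - Real.log (Y n))) (g / c)
      (fun n => -(g * d n + g ^ 2 / 2) / c ^ 2) := by
  have hs := (hY.inv hc.ne').const_mul g
  have hsu : (fun n => g * (Y n)⁻¹ * u n) =O[atTop] u := by
    simpa using hs.isBigO_one.mul (isBigO_refl u atTop)
  have h0 := isBigO_log_one_add_cubic.comp_tendsto (hsu.trans_tendsto hY.null)
  have h1 : (fun n => (u n)⁻¹ * (Real.log (1 + g * (Y n)⁻¹ * u n)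
      - (g * (Y n)⁻¹ * u n - (g * (Y n)⁻¹ * u n) ^ 2 / 2))) =O[atTop] fun n => u n ^ 2 := by
    refine ((isBigO_refl (fun n => (u n)⁻¹) atTop).mul (h0.trans (hsu.pow 3))).congr'
      EventuallyEq.rfl ?_
    filter_upwards [hu] with n hn
    field_simp
  refine ((hs.sub (hs.sq.const_mul (1 / 2)).null_mul).add (.of_isBigO hY.null h1)).congr ?_ ?_ ?_
  · filter_upwards [hu, hY.tendsto.eventually (lt_mem_nhds hc),
      (hY.add ((TwoTerm.const hY.null g).null_mul)).tendsto.eventually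
        (lt_mem_nhds (by simpa using hc))] with n hn hn1 hn2
    have e : 1 + g * (Y n)⁻¹ * u n = (Y n + u n * g) / Y n := by field_simp
    rw [e, Real.log_div hn2.ne' hn1.ne', mul_comm g (u n)]
    field_simp
    ring
  · field_simp; ring
  · intro n; field_simp; ring

theorem TwoTerm.sqrt_mul_realDigamma_sub {Y : ℕ → ℝ} {c : ℝ} {d : ℕ → ℝ}
    (hY : TwoTerm (fun n : ℕ => 1 / √(n : ℝ)) Y c d) (hc : 0 < c) (g : ℝ) :
    TwoTerm (fun n : ℕ => 1 / √(n : ℝ))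
      (fun n => √n * (realDigamma (n * (Y n + g * (1 / √n))) - realDigamma (n * Y n))) (g / c)
      (fun n => -(g * d n + g ^ 2 / 2) / c ^ 2) := by
  have hu : ∀ᶠ n : ℕ in atTop, 1 / √(n : ℝ) ≠ 0 := by
    filter_upwards [eventually_natCast_pos] with n hn
    positivity
  have hY' : TwoTerm (fun n : ℕ => 1 / √(n : ℝ)) (fun n => Y n + g * (1 / √n)) c
      (fun n => d n + g) :=
    (hY.add (TwoTerm.linear hY.null (isBigO_const_const g one_ne_zero _) 0)).congr
      (Eventually.of_forall fun n => by ring) (by ring) fun n => by ring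
  have h1 := (isBigO_realDigamma_mul hc hY'.tendsto).sub (isBigO_realDigamma_mul hc hY.tendsto)
  have h2 : (fun n : ℕ => √(n : ℝ) * ((realDigamma (n * (Y n + g * (1 / √n))) - Real.log n
      - (Real.log (Y n + g * (1 / √n)) - 1 / n * (1 / 2 * (Y n + g * (1 / √n))⁻¹)))
      - (realDigamma (n * Y n) - Real.log n - (Real.log (Y n) - 1 / n * (1 / 2 * (Y n)⁻¹)))))
      =O[atTop] fun n : ℕ => (1 / √(n : ℝ)) ^ 2 := by
    refine ((isBigO_refl (fun n : ℕ => √(n : ℝ)) atTop).mul h1).trans ?_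
    refine IsBigO.of_bound 1 ?_
    filter_upwards [eventually_ge_atTop 1] with n hn
    have hn1 : (1 : ℝ) ≤ n := by exact_mod_cast hn
    have hs : √(n : ℝ) ≤ n := Real.sqrt_le_iff.2 ⟨by linarith, by nlinarith⟩
    rw [one_div_sqrt_sq, Real.norm_of_nonneg (by positivity), Real.norm_of_nonneg (by positivity),
      one_mul]
    calc √(n : ℝ) * (1 / (n : ℝ)) ^ 2 ≤ n * (1 / (n : ℝ)) ^ 2 := by gcongr
      _ = 1 / (n : ℝ) := by field_simp
  have h3 := (((hY'.inv hc.ne').sub (hY.inv hc.ne')).const_mul (1 / 2))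
  -- The −1/(2X) corrections of the two digammas nearly cancel: their difference carries an extra
  -- factor 1/√n.
  have h4 : (fun n : ℕ => 1 / √(n : ℝ) * (1 / 2 * ((Y n + g * (1 / √n))⁻¹ - (Y n)⁻¹)))
      =O[atTop] fun n : ℕ => (1 / √(n : ℝ)) ^ 2 := by
    have h5 := h3.isBigO_sub
    simp only [sub_self, mul_zero, sub_zero] at h5
    simpa only [pow_two] using (isBigO_refl (fun n : ℕ => 1 / √(n : ℝ)) atTop).mul h5
  refine ((hY.inv_null_mul_log_sub_log hc g hu).add (.of_isBigO hY.null (h2.sub h4))).congr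
    ?_ (by ring) fun n => by ring
  filter_upwards [eventually_natCast_pos] with n hn
  have e1 : (1 / √(n : ℝ))⁻¹ = √n := by rw [one_div, inv_inv]
  have e2 : √(n : ℝ) * (1 / n) = 1 / √n := by
    rw [← one_div_sqrt_sq]
    have := (Real.sqrt_pos.2 hn).ne'
    field_simp
  rw [e1]
  linear_combination (1 / 2 * ((Y n + g * (1 / √n))⁻¹ - (Y n)⁻¹)) * e2

theorem TwoTerm.realTrigamma_mul_sqrt {Y : ℕ → ℝ} {c : ℝ} {d : ℕ → ℝ}
    (hY : TwoTerm (fun n : ℕ => 1 / √(n : ℝ)) Y c d) (hc : 0 < c) :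
    TwoTerm (fun n : ℕ => 1 / √(n : ℝ)) (fun n => n * realTrigamma (n * Y n))
      (1 / c) (fun n => -d n / c ^ 2) := by
  have h1 : (fun n : ℕ => 1 / (n : ℝ)) =O[atTop] fun n : ℕ => (1 / √(n : ℝ)) ^ 2 := by
    simp only [one_div_sqrt_sq]
    exact isBigO_refl _ _
  have h2 := (TwoTerm.isBigO_sq_null tendsto_one_div_natCast).trans h1
  have h3 : (fun n : ℕ => 1 / (n : ℝ) * (1 / 2 * (Y n)⁻¹ ^ 2))
      =O[atTop] fun n : ℕ => (1 / √(n : ℝ)) ^ 2 := by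
    simpa using h1.mul ((hY.inv hc.ne').sq.const_mul (1 / 2)).isBigO_one
  refine ((hY.inv hc.ne').add (.of_isBigO hY.null
    (((isBigO_realTrigamma_mul hc hY.tendsto).trans h2).add h3))).congr
    (Eventually.of_forall fun n => by ring) (by ring) fun n => by field_simp; ring

/-! ### From expansions of the scaled bound to the stated remainders -/

theorem isBigO_rpow_neg_of_le {p q : ℝ} (hpq : q ≤ p) :
    (fun n : ℕ => (n : ℝ) ^ (-p)) =O[atTop] fun n : ℕ => (n : ℝ) ^ (-q) := by
  refine IsBigO.of_bound 1 ?_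
  filter_upwards [eventually_ge_atTop 1] with n hn
  have hn1 : (1 : ℝ) ≤ n := by exact_mod_cast hn
  rw [Real.norm_of_nonneg (by positivity), Real.norm_of_nonneg (by positivity), one_mul]
  exact Real.rpow_le_rpow_of_exponent_le hn1 (by linarith)

theorem one_div_natCast_pow (n k : ℕ) : (1 / (n : ℝ)) ^ k = (n : ℝ) ^ (-(k : ℝ)) := by
  rw [Real.rpow_neg n.cast_nonneg, Real.rpow_natCast, one_div, inv_pow]

section

variable {F : ℕ → ℝ} {c : ℝ} {d : ℕ → ℝ}

/-- The expansion has error O(n⁻²), stronger than the exponent asked for. -/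
theorem TwoTerm.isBigO_rpow (h : TwoTerm (fun n : ℕ => 1 / (n : ℝ)) F c d) :
    (fun n => F n - (c + d n / n)) =O[atTop] fun n : ℕ => (n : ℝ) ^ (-(3 / 2) : ℝ) := by
  have h1 := h.err
  simp only [one_div_natCast_pow] at h1
  exact (h1.trans (isBigO_rpow_neg_of_le (by norm_num))).congr_left fun n => by ring

theorem TwoTerm.isBigO_rpow_of_mul (h : TwoTerm (fun n : ℕ => 1 / (n : ℝ)) (fun n => n * F n) c d) :
    (fun n => F n - (c / n + d n / (n : ℝ) ^ 2))
      =O[atTop] fun n : ℕ => (n : ℝ) ^ (-(5 / 2) : ℝ) := by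
  have h1 := (isBigO_refl (fun n : ℕ => 1 / (n : ℝ)) atTop).mul h.err
  simp only [← pow_succ', Nat.reduceAdd] at h1
  simp only [one_div_natCast_pow] at h1
  refine (h1.trans (isBigO_rpow_neg_of_le (q := 5 / 2) (by norm_num))).congr' ?_ EventuallyEq.rfl
  filter_upwards [eventually_natCast_pos] with n hn
  field_simp

theorem TwoTerm.isBigO_rpow_of_mul_sqrt
    (h : TwoTerm (fun n : ℕ => 1 / √(n : ℝ)) (fun n => n * F n) c d) :
    (fun n => F n - (c / n + d n / (n : ℝ) ^ (3 / 2 : ℝ)))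
      =O[atTop] fun n : ℕ => (n : ℝ) ^ (-2 : ℝ) := by
  have h1 := (isBigO_refl (fun n : ℕ => 1 / (n : ℝ)) atTop).mul h.err
  simp only [one_div_sqrt_sq, ← pow_two] at h1
  simp only [one_div_natCast_pow, Nat.cast_ofNat] at h1
  refine h1.congr' ?_ EventuallyEq.rfl
  filter_upwards [eventually_natCast_pos] with n hn
  have e : (n : ℝ) ^ (3 / 2 : ℝ) = n * √n := by
    rw [Real.sqrt_eq_rpow, show (3 / 2 : ℝ) = 1 + 1 / 2 by norm_num, Real.rpow_add hn,
      Real.rpow_one]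
  have hs := (Real.sqrt_pos.2 hn).ne'
  rw [e]
  field_simp

end

/-! ### The Rao-Cramér bound along a sequence of success counts -/

/-- The Rao-Cramér bound in terms of the rescaled Beta parameters `Y = (x + 1) / n`,
`Z = (n - x + 1) / n` and their shifts `Y'`, `Z'` by the weight. -/
theorem raoCramerBound_posterior_div {n : ℕ} {x γ k Y Z Y' Z' : ℝ} (hn : 1 ≤ n) (hx0 : 0 ≤ x)
    (hxn : x ≤ n) (hγ0 : 0 ≤ γ) (hγ1 : γ ≤ 1) (hk : 0 ≤ k) (hY : x + 1 = n * Y)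
    (hZ : n - x + 1 = n * Z) (hY' : x + 1 + γ * k = n * Y')
    (hZ' : n - x + 1 + (1 - γ) * k = n * Z') :
    raoCramerBound (posteriorPDF n) (peakWeight γ k) (x / n)
      = (1 / (n + 2 + k) - digammaShift (n * Y) (n * Z) (n * (Y' - Y)) (n * (Z' - Z))
          * (n * Y / (n + 2) - n * Y' / (n + 2 + k))) ^ 2
        / (realTrigamma (n * Y') + realTrigamma (n * Z')
          + digammaShift (n * Y) (n * Z) (n * (Y' - Y)) (n * (Z' - Z)) ^ 2) := by
  have hn0 : (n : ℝ) ≠ 0 := by positivity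
  have e1 : n * (x / n) = x := by field_simp
  have e2 : n * (1 - x / n) = n - x := by field_simp
  rw [raoCramerBound_posterior hn (by rw [e1]; linarith) (by rw [e2]; linarith)
    (mul_nonneg hγ0 hk) (mul_nonneg (by linarith) hk), e1, e2, hY', hZ', hY, hZ,
    show γ * k = n * (Y' - Y) by linarith, show (1 - γ) * k = n * (Z' - Z) by linarith]

theorem raoCramerBound_div_le {n : ℕ} {x γ k : ℝ} (hn : 1 ≤ n) (hx0 : 0 ≤ x)
    (hxn : x ≤ n) (hγ0 : 0 ≤ γ) (hγ1 : γ ≤ 1) (hk : 0 ≤ k) :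
    raoCramerBound (posteriorPDF n) (peakWeight γ k) (x / n)
      ≤ weightedVariance (posteriorPDF n) (peakWeight γ k) (x / n) := by
  have hn0 : (n : ℝ) ≠ 0 := by positivity
  have e1 : n * (x / n) = x := by field_simp
  have e2 : n * (1 - x / n) = n - x := by field_simp
  exact raoCramerBound_posterior_le_weightedVariance hn (by rw [e1]; linarith)
    (by rw [e2]; linarith) (mul_nonneg hγ0 hk) (mul_nonneg (by linarith) hk)

/-! ### The three weight exponents -/

theorem mul_sq_div_mul {m : ℝ} (hm : m ≠ 0) (P T : ℝ) :
    (m * P) ^ 2 / (m * T) = m * (P ^ 2 / T) := by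
  field_simp

theorem eventually_one_div_natCast_ne_zero : ∀ᶠ n : ℕ in atTop, 1 / (n : ℝ) ≠ 0 := by
  filter_upwards [eventually_natCast_pos] with n hn
  positivity

section

variable {α γ : ℝ} {x : ℕ → ℝ}

theorem isBigO_mul_sub_one (hxα : ∀ n, x n ≤ α * n) (hα : ∀ n, α * n - x n ≤ 1) :
    (fun n : ℕ => α * n - x n) =O[atTop] fun _ => (1 : ℝ) := by
  refine IsBigO.of_bound 1 (Eventually.of_forall fun n => ?_)
  rw [Real.norm_of_nonneg (by linarith [hxα n]), norm_one, mul_one]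
  exact hα n

theorem twoTerm_affine {u δ : ℕ → ℝ} (hu : Tendsto u atTop (𝓝 0))
    (hδ : δ =O[atTop] fun _ => (1 : ℝ)) (c e s : ℝ) :
    TwoTerm u (fun n => c + (e + s * δ n) * u n) c (fun n => e + s * δ n) :=
  .linear hu ((isBigO_const_const e one_ne_zero _).add (hδ.const_mul_left s)) c

theorem twoTerm_one_add {u : ℕ → ℝ} (hu : Tendsto u atTop (𝓝 0)) (c e : ℝ) :
    TwoTerm u (fun n => c + e * u n) c (fun _ => e) :=
  .linear hu (isBigO_const_const e one_ne_zero _) c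

/-- D and E have zero constant term, so n D E and n D² are O(1/n). Scaling the base of the
numerator's square and the denominator by n gives limits 1 and 1/(α(1 − α)). -/
theorem twoTerm_raoCramerBound_one (hα0 : 0 < α) (hα1 : α < 1) (hγ0 : 0 ≤ γ) (hγ1 : γ ≤ 1)
    (hx0 : ∀ n, 0 ≤ x n) (hxα : ∀ n, x n ≤ α * n) (hα : ∀ n, α * n - x n ≤ 1) :
    TwoTerm (fun n : ℕ => 1 / (n : ℝ))
      (fun n => n * raoCramerBound (posteriorPDF n) (peakWeight γ 1) (x n / n))
      (α * (1 - α))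
      (fun n => (1 - 14 * α + 18 * α ^ 2 + 2 * γ - 8 * α * γ + 2 * γ ^ 2) / 2
        - (1 - 2 * α) * (α * n - x n)) := by
  have hu := tendsto_one_div_natCast
  have hδ := isBigO_mul_sub_one hxα hα
  have hβ : 0 < 1 - α := by linarith
  have hY := twoTerm_affine hu hδ α 1 (-1)
  have hZ := twoTerm_affine hu hδ (1 - α) 1 1
  have hY' := twoTerm_affine hu hδ α (1 + γ) (-1)
  have hZ' := twoTerm_affine hu hδ (1 - α) (2 - γ) 1
  have h2 := twoTerm_one_add hu 1 2
  have h3 := twoTerm_one_add hu 1 3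
  have hD := (twoTerm_digammaShift hY hα0 hZ hβ hY' hα0 hZ' hβ).congr
    (Eventually.of_forall fun n => rfl) (sub_self _) (fun n => rfl)
  have hE := ((hY.div h2 one_ne_zero).sub (hY'.div h3 one_ne_zero)).congr
    (Eventually.of_forall fun n => rfl) (sub_self _) (fun n => rfl)
  have hN := ((TwoTerm.const hu 1).div h3 one_ne_zero).sub
    (hD.inv_null_mul_mul hE eventually_one_div_natCast_ne_zero)
  have hT := ((hY'.realTrigamma_mul hα0).add (hZ'.realTrigamma_mul hβ)).add
    (hD.inv_null_mul_mul hD eventually_one_div_natCast_ne_zero)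
  refine (hN.sq.div hT (by positivity)).congr ?_ ?_ ?_
  · filter_upwards [eventually_ge_atTop 1] with n hn
    have hn0 : (n : ℝ) ≠ 0 := by positivity
    have hαn : α * n ≤ n := by nlinarith [n.cast_nonneg (α := ℝ)]
    rw [raoCramerBound_posterior_div hn (hx0 n) ((hxα n).trans hαn) hγ0 hγ1 zero_le_one
      (Y := α + (1 + -1 * (α * n - x n)) * (1 / n))
      (Z := 1 - α + (1 + 1 * (α * n - x n)) * (1 / n))
      (Y' := α + (1 + γ + -1 * (α * n - x n)) * (1 / n))
      (Z' := 1 - α + (2 - γ + 1 * (α * n - x n)) * (1 / n))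
      (by field_simp; ring) (by field_simp; ring) (by field_simp; ring) (by field_simp; ring),
      ← mul_sq_div_mul hn0]
    generalize digammaShift _ _ _ _ = D
    generalize realTrigamma _ = T₁
    generalize realTrigamma _ = T₂
    congr 2
    · field_simp
      ring
    · field_simp
  · field_simp
    ring
  · intro n
    field_simp
    ring

theorem twoTerm_raoCramerBound_natCast (hα0 : 0 < α) (hα1 : α < 1) (hγ0 : 0 ≤ γ) (hγ1 : γ ≤ 1)
    (hx0 : ∀ n, 0 ≤ x n) (hxα : ∀ n, x n ≤ α * n) (hα : ∀ n, α * n - x n ≤ 1) (hγα : γ ≠ α) :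
    TwoTerm (fun n : ℕ => 1 / (n : ℝ))
      (fun n => raoCramerBound (posteriorPDF n) (peakWeight γ n) (x n / n))
      ((α - γ) ^ 2 / 4)
      (fun n => constC3 α γ - (α - γ) / 2 * (α * n - x n)) := by
  have hu := tendsto_one_div_natCast
  have hδ := isBigO_mul_sub_one hxα hα
  have hβ : 0 < 1 - α := by linarith
  have hs : 0 < α + γ := by linarith
  have hr : 0 < 2 - α - γ := by linarith
  have hY := twoTerm_affine hu hδ α 1 (-1)
  have hZ := twoTerm_affine hu hδ (1 - α) 1 1
  have hY' := twoTerm_affine hu hδ (α + γ) 1 (-1)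
  have hZ' := twoTerm_affine hu hδ (2 - α - γ) 1 1
  have h2 := twoTerm_one_add hu 1 2
  have h3 := twoTerm_one_add hu 2 2
  set L := Real.log ((1 - α) * (α + γ) / (α * (2 - α - γ))) with hL
  have hLeq : Real.log (α + γ) - Real.log (2 - α - γ) - (Real.log α - Real.log (1 - α)) = L := by
    rw [hL, Real.log_div (by positivity) (by positivity), Real.log_mul hβ.ne' hs.ne',
      Real.log_mul hα0.ne' hr.ne']
    ring
  -- (1 − α)(α + γ) = α(2 − α − γ) holds only for γ = α.
  have hL0 : L ≠ 0 := by
    refine Real.log_ne_zero_of_pos_of_ne_one (by positivity) fun h => hγα ?_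
    rw [div_eq_one_iff_eq (by positivity)] at h
    linarith
  have hD := (twoTerm_digammaShift hY hα0 hZ hβ hY' hs hZ' hr).congr
    (Eventually.of_forall fun n => rfl) hLeq (fun n => rfl)
  have hE := (hY.div h2 one_ne_zero).sub (hY'.div h3 two_ne_zero)
  have hN := ((TwoTerm.const hu 1).div h3 two_ne_zero).null_mul.sub (hD.mul hE)
  have hT := ((hY'.realTrigamma_mul hs).add (hZ'.realTrigamma_mul hr)).null_mul.add hD.sq
  refine (hN.sq.div hT (by simpa using hL0)).congr ?_ ?_ ?_
  · filter_upwards [eventually_ge_atTop 1] with n hn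
    have hn0 : (n : ℝ) ≠ 0 := by positivity
    have hαn : α * n ≤ n := by nlinarith [n.cast_nonneg (α := ℝ)]
    rw [raoCramerBound_posterior_div hn (hx0 n) ((hxα n).trans hαn) hγ0 hγ1 n.cast_nonneg
      (Y := α + (1 + -1 * (α * n - x n)) * (1 / n))
      (Z := 1 - α + (1 + 1 * (α * n - x n)) * (1 / n))
      (Y' := α + γ + (1 + -1 * (α * n - x n)) * (1 / n))
      (Z' := 2 - α - γ + (1 + 1 * (α * n - x n)) * (1 / n))
      (by field_simp; ring) (by field_simp; ring) (by field_simp; ring) (by field_simp; ring)]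
    generalize digammaShift _ _ _ _ = D
    generalize realTrigamma _ = T₁
    generalize realTrigamma _ = T₂
    congr 2
    · field_simp
      ring
    · field_simp
  · field_simp
    ring
  · intro n
    rw [constC3, if_neg hγα, ← hL]
    field_simp
    ring

/-- The weight doubles both limiting shapes, so the log-odds limit does not move and D, E are
O(1/n). Only the limit of n times the bound is needed; the final factor 1/n discards its next term.
-/
theorem twoTerm_raoCramerBound_natCast_self (hα0 : 0 < α) (hα1 : α < 1)
    (hx0 : ∀ n, 0 ≤ x n) (hxα : ∀ n, x n ≤ α * n) (hα : ∀ n, α * n - x n ≤ 1) :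
    TwoTerm (fun n : ℕ => 1 / (n : ℝ))
      (fun n => raoCramerBound (posteriorPDF n) (peakWeight α n) (x n / n))
      0 (fun _ => α * (1 - α) / 2) := by
  have hu := tendsto_one_div_natCast
  have hδ := isBigO_mul_sub_one hxα hα
  have hβ : 0 < 1 - α := by linarith
  have hs : 0 < 2 * α := by linarith
  have hr : 0 < 2 * (1 - α) := by linarith
  have hY := twoTerm_affine hu hδ α 1 (-1)
  have hZ := twoTerm_affine hu hδ (1 - α) 1 1
  have hY' := twoTerm_affine hu hδ (2 * α) 1 (-1)
  have hZ' := twoTerm_affine hu hδ (2 * (1 - α)) 1 1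
  have h2 := twoTerm_one_add hu 1 2
  have h3 := twoTerm_one_add hu 2 2
  have hD := (twoTerm_digammaShift hY hα0 hZ hβ hY' hs hZ' hr).congr (c' := 0)
    (Eventually.of_forall fun n => rfl) (by
      rw [Real.log_mul two_ne_zero hα0.ne', Real.log_mul two_ne_zero hβ.ne']; ring) (fun n => rfl)
  have hE := ((hY.div h2 one_ne_zero).sub (hY'.div h3 two_ne_zero)).congr (c' := 0)
    (Eventually.of_forall fun n => rfl) (by field_simp; ring) (fun n => rfl)
  have hN := ((TwoTerm.const hu 1).div h3 two_ne_zero).sub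
    (hD.inv_null_mul_mul hE eventually_one_div_natCast_ne_zero)
  have hT := ((hY'.realTrigamma_mul hs).add (hZ'.realTrigamma_mul hr)).add
    (hD.inv_null_mul_mul hD eventually_one_div_natCast_ne_zero)
  refine (hN.sq.div hT (by positivity)).null_mul.congr ?_ rfl ?_
  · filter_upwards [eventually_ge_atTop 1] with n hn
    have hn0 : (n : ℝ) ≠ 0 := by positivity
    have hαn : α * n ≤ n := by nlinarith [n.cast_nonneg (α := ℝ)]
    rw [raoCramerBound_posterior_div hn (hx0 n) ((hxα n).trans hαn) hα0.le hα1.le n.cast_nonneg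
      (Y := α + (1 + -1 * (α * n - x n)) * (1 / n))
      (Z := 1 - α + (1 + 1 * (α * n - x n)) * (1 / n))
      (Y' := 2 * α + (1 + -1 * (α * n - x n)) * (1 / n))
      (Z' := 2 * (1 - α) + (1 + 1 * (α * n - x n)) * (1 / n))
      (by field_simp; ring) (by field_simp; ring) (by field_simp; ring) (by field_simp; ring)]
    generalize digammaShift _ _ _ _ = D
    generalize realTrigamma _ = T₁
    generalize realTrigamma _ = T₂
    rw [one_div_mul_eq_div, div_eq_iff hn0, mul_comm (_ / _) (n : ℝ), ← mul_sq_div_mul hn0]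
    congr 2
    · field_simp
      ring
    · field_simp
  · intro n
    field_simp
    ring

theorem twoTerm_raoCramerBound_sqrt (hα0 : 0 < α) (hα1 : α < 1) (hγ0 : 0 ≤ γ) (hγ1 : γ ≤ 1)
    (hx0 : ∀ n, 0 ≤ x n) (hxα : ∀ n, x n ≤ α * n) (hα : ∀ n, α * n - x n ≤ 1) :
    TwoTerm (fun n : ℕ => 1 / √(n : ℝ))
      (fun n => n * raoCramerBound (posteriorPDF n) (peakWeight γ (√n)) (x n / n))
      (α * (1 - α) + (α - γ) ^ 2)
      (fun _ => -2 * α + α ^ 2 + γ + 2 * α * γ - 2 * γ ^ 2) := by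
  have hu := tendsto_one_div_sqrt_natCast
  have hδ := isBigO_mul_sub_one hxα hα
  have hβ : 0 < 1 - α := by linarith
  -- The rounding defect enters at order 1/n = u², inside the error, so it is absent from the
  -- coefficients for k = √n.
  have hquad {δ : ℕ → ℝ} (hδ : δ =O[atTop] fun _ => (1 : ℝ)) (c e s g : ℝ) :
      TwoTerm (fun n : ℕ => 1 / √(n : ℝ))
        (fun n => c + (e + s * δ n) * (1 / √(n : ℝ)) ^ 2 + g * (1 / √n)) c (fun _ => g) := by
    have h : (fun n : ℕ => (e + s * δ n) * (1 / √(n : ℝ)) ^ 2)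
        =O[atTop] fun n : ℕ => (1 / √(n : ℝ)) ^ 2 := by
      simpa only [one_mul] using
        ((isBigO_const_const e one_ne_zero _).add (hδ.const_mul_left s)).mul
          (isBigO_refl (fun n : ℕ => (1 / √(n : ℝ)) ^ 2) atTop)
    exact ((twoTerm_one_add hu c g).add (.of_isBigO hu h)).congr
      (Eventually.of_forall fun n => by ring) (add_zero c) fun n => add_zero g
  have hY := (hquad hδ α 1 (-1) 0).congr (Eventually.of_forall fun n => by
    rw [zero_mul, add_zero]) rfl fun n => rfl
  have hZ := (hquad hδ (1 - α) 1 1 0).congr (Eventually.of_forall fun n => by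
    rw [zero_mul, add_zero]) rfl fun n => rfl
  have hY' := hquad hδ α 1 (-1) γ
  have hZ' := hquad hδ (1 - α) 1 1 (1 - γ)
  -- With δ = 1 and e = s = 1 the u² coefficient is 2, giving (n + 2)/n; the next line gives (n + 2
  -- + √n)/n.
  have h2 := hquad (isBigO_refl (fun _ : ℕ => (1 : ℝ)) atTop) 1 1 1 0
  have h3 := hquad (isBigO_refl (fun _ : ℕ => (1 : ℝ)) atTop) 1 1 1 1
  have hD := (hY.sqrt_mul_realDigamma_sub hα0 γ).sub (hZ.sqrt_mul_realDigamma_sub hβ (1 - γ))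
  -- This is √n · E exactly: over a common denominator the difference of means has a factor k = √n,
  -- so nothing is lost by rescaling.
  have hE := (hY.sub (h2.const_mul γ)).div (h2.mul h3) (by norm_num)
  have hN := ((TwoTerm.const hu 1).div h3 one_ne_zero).sub (hD.mul hE)
  have hT := ((hY'.realTrigamma_mul_sqrt hα0).add (hZ'.realTrigamma_mul_sqrt hβ)).add hD.sq
  have hne : α * (1 - α) + (α - γ) ^ 2 ≠ 0 := by positivity
  have hTeq : 1 / α + 1 / (1 - α) + (γ / α - (1 - γ) / (1 - α)) ^ 2
      = (α * (1 - α) + (α - γ) ^ 2) / (α * (1 - α)) ^ 2 := by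
    field_simp
    ring
  have hT' := hT.congr (Eventually.of_forall fun n => rfl) hTeq fun n => rfl
  refine (hN.sq.div hT' (by positivity)).congr ?_ ?_ ?_
  · filter_upwards [eventually_ge_atTop 1] with n hn
    have hn0 : (n : ℝ) ≠ 0 := by positivity
    have hαn : α * n ≤ n := by nlinarith [n.cast_nonneg (α := ℝ)]
    have hs : 0 < √(n : ℝ) := by positivity
    have hss : (n : ℝ) = √(n : ℝ) ^ 2 := (Real.sq_sqrt n.cast_nonneg).symm
    rw [raoCramerBound_posterior_div hn (hx0 n) ((hxα n).trans hαn) hγ0 hγ1 hs.le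
      (Y := α + (1 + -1 * (α * n - x n)) * (1 / √(n : ℝ)) ^ 2)
      (Z := 1 - α + (1 + 1 * (α * n - x n)) * (1 / √(n : ℝ)) ^ 2)
      (Y' := α + (1 + -1 * (α * n - x n)) * (1 / √(n : ℝ)) ^ 2 + γ * (1 / √n))
      (Z' := 1 - α + (1 + 1 * (α * n - x n)) * (1 / √(n : ℝ)) ^ 2 + (1 - γ) * (1 / √n))
      (by rw [one_div_sqrt_sq]; field_simp; ring) (by rw [one_div_sqrt_sq]; field_simp; ring)
      (by rw [one_div_sqrt_sq]; field_simp; linear_combination -γ * hss)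
      (by rw [one_div_sqrt_sq]; field_simp; linear_combination -(1 - γ) * hss),
      ← mul_sq_div_mul hn0]
    have e : ∀ a b : ℝ, n * a + n * (b - a) = n * b := fun a b => by ring
    simp only [digammaShift, e]
    generalize realDigamma _ = D₁
    generalize realDigamma _ = D₂
    generalize realDigamma _ = D₃
    generalize realDigamma _ = D₄
    generalize realTrigamma _ = T₁
    generalize realTrigamma _ = T₂
    generalize α + (1 + -1 * (α * n - x n)) * (1 / √(n : ℝ)) ^ 2 = Y
    generalize √(n : ℝ) = s at *
    rw [hss]
    congr 2
    · field_simp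
      ring
    · ring
  · field_simp
    ring
  · intro n
    field_simp
    ring

end

end

/-! ### Assembly of the three weight exponents. -/

theorem theorem8 (α γ : ℝ) (hα0 : 0 < α) (hα1 : α < 1) (hγ0 : 0 ≤ γ) (hγ1 : γ ≤ 1)
    (x : ℕ → ℝ) (hx : (∀ n : ℕ, x n = (⌊α * n⌋₊ : ℝ)) ∨ (∀ n : ℕ, x n = α * n)) :
    -- weight exponent `k = 1`
    ((∀ n : ℕ, 1 ≤ n →
        raoCramerBound (posteriorPDF n) (peakWeight γ 1) (x n / n)
          ≤ weightedVariance (posteriorPDF n) (peakWeight γ 1) (x n / n)) ∧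
      (fun n : ℕ => raoCramerBound (posteriorPDF n) (peakWeight γ 1) (x n / n)
          - (α * (1 - α) / n
            + ((1 - 14 * α + 18 * α ^ 2 + 2 * γ - 8 * α * γ + 2 * γ ^ 2) / 2
                - (1 - 2 * α) * (α * n - x n)) / (n : ℝ) ^ 2))
        =O[atTop] fun n : ℕ => (n : ℝ) ^ (-(5 / 2) : ℝ)) ∧
    -- weight exponent `k = √n`
    ((∀ n : ℕ, 1 ≤ n →
        raoCramerBound (posteriorPDF n) (peakWeight γ (√n)) (x n / n)
          ≤ weightedVariance (posteriorPDF n) (peakWeight γ (√n)) (x n / n)) ∧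
      (fun n : ℕ => raoCramerBound (posteriorPDF n) (peakWeight γ (√n)) (x n / n)
          - ((α * (1 - α) + (α - γ) ^ 2) / n
            + (-2 * α + α ^ 2 + γ + 2 * α * γ - 2 * γ ^ 2) / (n : ℝ) ^ (3 / 2 : ℝ)))
        =O[atTop] fun n : ℕ => (n : ℝ) ^ (-2 : ℝ)) ∧
    -- weight exponent `k = n`
    ((∀ n : ℕ, 1 ≤ n →
        raoCramerBound (posteriorPDF n) (peakWeight γ n) (x n / n)
          ≤ weightedVariance (posteriorPDF n) (peakWeight γ n) (x n / n)) ∧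
      (fun n : ℕ => raoCramerBound (posteriorPDF n) (peakWeight γ n) (x n / n)
          - ((α - γ) ^ 2 / 4 + (constC3 α γ - (α - γ) / 2 * (α * n - x n)) / n))
        =O[atTop] fun n : ℕ => (n : ℝ) ^ (-(3 / 2) : ℝ)) := by
  -- Both choices of x enter only through these inequalities.
  have hbounds : ∀ n : ℕ, 0 ≤ x n ∧ x n ≤ α * n ∧ α * n - x n ≤ 1 := by
    intro n
    have h0 : 0 ≤ α * n := by positivity
    rcases hx with h | h
    · rw [h n]
      exact ⟨by positivity, Nat.floor_le h0, by linarith [Nat.lt_floor_add_one (α * n)]⟩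
    · rw [h n]
      exact ⟨h0, le_rfl, by linarith⟩
  have hx0 := fun n => (hbounds n).1
  have hxα := fun n => (hbounds n).2.1
  have hα := fun n => (hbounds n).2.2
  have hxn : ∀ n : ℕ, x n ≤ n := fun n =>
    (hxα n).trans (by nlinarith [n.cast_nonneg (α := ℝ)])
  refine ⟨⟨fun n hn => raoCramerBound_div_le hn (hx0 n) (hxn n) hγ0 hγ1 zero_le_one,
      (twoTerm_raoCramerBound_one hα0 hα1 hγ0 hγ1 hx0 hxα hα).isBigO_rpow_of_mul⟩,
    ⟨fun n hn => raoCramerBound_div_le hn (hx0 n) (hxn n) hγ0 hγ1 (Real.sqrt_nonneg _),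
      (twoTerm_raoCramerBound_sqrt hα0 hα1 hγ0 hγ1 hx0 hxα hα).isBigO_rpow_of_mul_sqrt⟩,
    ⟨fun n hn => raoCramerBound_div_le hn (hx0 n) (hxn n) hγ0 hγ1 n.cast_nonneg, ?_⟩⟩
  by_cases hγα : γ = α
  · subst hγα
    refine (twoTerm_raoCramerBound_natCast_self hα0 hα1 hx0 hxα hα).isBigO_rpow.congr_left
      fun n => ?_
    rw [constC3, if_pos rfl]
    ring
  · exact (twoTerm_raoCramerBound_natCast hα0 hα1 hγ0 hγ1 hx0 hxα hα hγα).isBigO_rpow
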